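/- \textbf{Setting.} Let $S$ and $\Omega$ be Polish spaces with their Borel $\sigma$-fields and let $r$ be a probability measure on $\Omega$. For a Polish space $E$, $\mathcal P(E)$ denotes the space of probability measures on $E$ with the topology of weak convergence and its Borel $\sigma$-field. Let $\kappa:\Omega\to\mathbb N\cup\{\infty\}$ be measurable, $\Omega_k:=\{\omega\in\Omega:\kappa(\omega)=k\}$, and let $\gamma$ be a function from the disjoint union $\bigcup_{k\in\mathbb N\cup\{\infty\}}\Omega_k\times S^k$ into $S$ such that for each $k\in\mathbb N\cup\{\infty\}$ the map $\Omega_k\times S^k\ni(\omega,x)\mapsto\gamma[\omega](x)\in S$ is jointly measurable (here $S^0$ is a one-point set and $S^\infty=S^{\{1,2,\ldots\}}$). For measurable $g:S^k\to S$ and $\mu_1,\mu_2,\ldots\in\mathcal P(S)$, let $\check g(\mu_1,\ldots,\mu_k)\in\mathcal P(S)$ be the image of the product measure $\mu_1\otimes\cdots\otimes\mu_k$ under $g$, and let $T_g(\mu):=\check g(\mu,\ldots,\mu)$. Define $$T(\mu):=\int_\Omega r(\mathrm d\omega)\,T_{\gamma[\omega]}(\mu)\quad(\mu\in\mathcal P(S)).$$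 For each $\omega$, let $\check\gamma[\omega]:\mathcal P(S)^{\kappa(\omega)}\to\mathcal P(S)$ be the map $\check g$ with $g=\gamma[\omega]$, and define the higher-level map $\check T:\mathcal P(\mathcal P(S))\to\mathcal P(\mathcal P(S))$ by $$\check T(\rho):=\int_\Omega r(\mathrm d\omega)\,T_{\check\gamma[\omega]}(\rho)\quad(\rho\in\mathcal P(\mathcal P(S))),$$ where $T_{\check\gamma[\omega]}(\rho)$ is the image of the product measure $\rho^{\otimes\kappa(\omega)}$ under $\check\gamma[\omega]$. For $\mu\in\mathcal P(S)$, let $\mathcal P(\mathcal P(S))_\mu$ be the set of all $\rho\in\mathcal P(\mathcal P(S))$ whose first moment measure $\rho^{(1)}:=\int\rho(\mathrm d\xi)\,\xi$ equals $\mu$; let $\delta_\mu\in\mathcal P(\mathcal P(S))$ be the Dirac measure at $\mu$, and let $\overline\mu\in\mathcal P(\mathcal P(S))$ be the law of the random measure $\delta_X$, where $X$ has law $\mu$. For $\rho_1,\rho_2\in\mathcal P(\mathcal P(S))$ write $\rho_1\le_{\rm cv}\rho_2$ (convex order) if there exist an $S$-valued random variable $X$ on some probability space $(E,\mathcal F,\mathbb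 P)$ and sub-$\sigma$-fields $\mathcal F_1\subset\mathcal F_2\subset\mathcal F$ such that $\rho_i$ is the law of the conditional law $\mathbb P[X\in\cdot\,|\,\mathcal F_i]$, for $i=1,2$. \textbf{Proposition (Minimal and maximal solutions).} The map $\check T$ is monotone w.r.t. the convex order: $\rho_1\le_{\rm cv}\rho_2$ implies $\check T(\rho_1)\le_{\rm cv}\check T(\rho_2)$ for all $\rho_1,\rho_2\in\mathcal P(\mathcal P(S))$. Let $\mu\in\mathcal P(S)$ satisfy $T(\mu)=\mu$. Then $\check T$ maps $\mathcal P(\mathcal P(S))_\mu$ into itself. There exists a unique $\underline\mu\in\mathcal P(\mathcal P(S))_\mu$ such that $\check T^t(\delta_\mu)\Rightarrow\underline\mu$ as $t\to\infty$, where $\Rightarrow$ denotes weak convergence of probability measures on $\mathcal P(S)$. Moreover, $\check T(\underline\mu)=\underline\mu$ and $\check T(\overline\mu)=\overline\mu$, and every $\rho\in\mathcal P(\mathcal P(S))_\mu$ with $\check T(\rho)=\rho$ satisfies $$\underline\mu\le_{\rm cv}\rho\le_{\rm cv}\overline\mu.$$ -/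

import Mathlib

open MeasureTheory Filter Topology

universe u v

namespace HigherRDE

/-! ### Laws of images of product measures -/

section CheckMap

variable {S : Type u} [MeasurableSpace S]

/-- The map `ǧ` on probability measures induced by a measurable map `g : S^ι → S`: if `X i` are
independent with laws `ν i`, then `checkMap g hg ν` is the law of `g ((X i)_i)`. -/
noncomputable def checkMap {ι : Type} (g : (ι → S) → S) (hg : Measurable g)
    (ν : ι → ProbabilityMeasure S) : ProbabilityMeasure S :=
  ⟨(Measure.infinitePi fun i => (ν i : Measure S)).map g,
    Measure.isProbabilityMeasure_map hg.aemeasurable⟩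

/-- The map `T_g(μ) = ǧ(μ, μ, …)`. -/
noncomputable def mapT {ι : Type} (g : (ι → S) → S) (hg : Measurable g)
    (μ : ProbabilityMeasure S) : ProbabilityMeasure S :=
  checkMap g hg fun _ => μ

/-- Forming product measures is measurable in the factors. -/
theorem measurable_infinitePi (ι : Type) :
    Measurable fun ν : ι → ProbabilityMeasure S =>
      Measure.infinitePi fun i => (ν i : Measure S) := by
  refine Measurable.measure_of_isPiSystem_of_isProbabilityMeasure
    (S := squareCylinders fun _ : ι => {s : Set S | MeasurableSet s})
    generateFrom_squareCylinders.symm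
    (isPiSystem_squareCylinders (fun _ => MeasurableSpace.isPiSystem_measurableSet)
      fun _ => MeasurableSet.univ) ?_
  rintro _ ⟨s, t, ht, rfl⟩
  have ht' : ∀ i, MeasurableSet (t i) := fun i => ht i (Set.mem_univ i)
  have h : ∀ ν : ι → ProbabilityMeasure S,
      Measure.infinitePi (fun i => (ν i : Measure S)) ((s : Set ι).pi t)
        = ∏ i ∈ s, (ν i : Measure S) (t i) := fun ν =>
    Measure.infinitePi_pi (fun i => (ν i : Measure S)) (fun i _ => ht' i)
  simp only [h]
  exact Finset.measurable_prod _ fun i _ =>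
    (Measure.measurable_coe (ht' i)).comp (measurable_subtype_coe.comp (measurable_pi_apply i))

/-- Joint measurability of `(a, ν) ↦ ǧ_a(ν)` if `(a, x) ↦ g_a(x)` is jointly measurable. -/
theorem measurable_checkMap {α : Type v} [MeasurableSpace α] {ι : Type}
    (g : α → (ι → S) → S) (hg : Measurable fun p : α × (ι → S) => g p.1 p.2) :
    Measurable fun p : α × (ι → ProbabilityMeasure S) =>
      checkMap (g p.1) (hg.comp measurable_prodMk_left) p.2 := by
  refine Measurable.subtype_mk (Measure.measurable_of_measurable_coe _ fun A hA => ?_)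
  let K : ProbabilityTheory.Kernel (α × (ι → ProbabilityMeasure S)) (ι → S) :=
    ⟨fun p => Measure.infinitePi fun i => (p.2 i : Measure S),
      (measurable_infinitePi ι).comp measurable_snd⟩
  have : ProbabilityTheory.IsMarkovKernel K :=
    ⟨fun p => inferInstanceAs
      (IsProbabilityMeasure (Measure.infinitePi fun i => (p.2 i : Measure S)))⟩
  have hm : Measurable fun q : (α × (ι → ProbabilityMeasure S)) × (ι → S) => g q.1.1 q.2 :=
    hg.comp (measurable_fst.fst.prodMk measurable_snd)
  have := ProbabilityTheory.Kernel.measurable_kernel_prodMk_left (κ := K) (hm hA)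
  convert this using 2 with p
  exact Measure.map_apply (hg.comp measurable_prodMk_left) hA

end CheckMap

/-! ### The random map `γ` -/

/-- The index set `{1, …, k}` (written as `{0, …, k - 1}`) for `k ∈ ℕ`, all of `ℕ` for `k = ∞`. -/
abbrev Idx (k : ℕ∞) : Type := {i : ℕ // (i : ℕ∞) < k}

/-- A random map with source of randomness `Ω`: a measurable `κ : Ω → ℕ ∪ {∞}` together with a
function `γ` on the disjoint union over `k` of `Ω_k × S^k`, where `Ω_k = {ω | κ ω = k}`, whose
restriction to each `Ω_k × S^k` is jointly measurable. -/
structure RandomMap (Ω : Type v) (S : Type u) [MeasurableSpace Ω] [MeasurableSpace S] where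
  κ : Ω → ℕ∞
  measurable_κ : Measurable κ
  γ : (k : ℕ∞) → {ω : Ω // κ ω = k} → (Idx k → S) → S
  measurable_γ : ∀ k, Measurable fun p : {ω : Ω // κ ω = k} × (Idx k → S) => γ k p.1 p.2

namespace RandomMap

variable {Ω : Type v} {S : Type u} [MeasurableSpace Ω] [MeasurableSpace S]

/-- The map `γ[ω] : S^{κ(ω)} → S`. -/
def eval (D : RandomMap Ω S) (ω : Ω) : (Idx (D.κ ω) → S) → S :=
  D.γ (D.κ ω) ⟨ω, rfl⟩

theorem measurable_γ_apply (D : RandomMap Ω S) (k : ℕ∞) (ω : {ω : Ω // D.κ ω = k}) :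
    Measurable (D.γ k ω) :=
  (D.measurable_γ k).comp measurable_prodMk_left

theorem measurable_eval (D : RandomMap Ω S) (ω : Ω) : Measurable (D.eval ω) :=
  D.measurable_γ_apply _ _

/-- The random map `γ̌`, acting on probability measures, with `γ̌[ω]` the map `ǧ` for
`g = γ[ω]`. -/
noncomputable def check (D : RandomMap Ω S) : RandomMap Ω (ProbabilityMeasure S) where
  κ := D.κ
  measurable_κ := D.measurable_κ
  γ := fun k ω => checkMap (D.γ k ω) (D.measurable_γ_apply k ω)
  measurable_γ := fun k => measurable_checkMap (D.γ k) (D.measurable_γ k)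

theorem measurable_mapT_eval (D : RandomMap Ω S) (μ : ProbabilityMeasure S) :
    Measurable fun ω => mapT (D.eval ω) (D.measurable_eval ω) μ := by
  intro B hB
  have hk : ∀ k : ℕ∞, MeasurableSet {ω : {ω : Ω // D.κ ω = k} |
      checkMap (D.γ k ω) (D.measurable_γ_apply k ω) (fun _ => μ) ∈ B} := fun k =>
    ((D.check.measurable_γ k).comp (measurable_id.prodMk measurable_const)) hB
  have hU : (fun ω => mapT (D.eval ω) (D.measurable_eval ω) μ) ⁻¹' B
      = ⋃ k : ℕ∞, Subtype.val '' {ω : {ω : Ω // D.κ ω = k} |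
          checkMap (D.γ k ω) (D.measurable_γ_apply k ω) (fun _ => μ) ∈ B} := by
    ext ω
    simp only [Set.mem_preimage, Set.mem_iUnion, Set.mem_image]
    constructor
    · intro h
      exact ⟨D.κ ω, ⟨ω, rfl⟩, h, rfl⟩
    · rintro ⟨k, ⟨ω', rfl⟩, h, rfl⟩
      exact h
  rw [hU]
  exact MeasurableSet.iUnion fun k =>
    (D.measurable_κ (measurableSet_singleton k)).subtype_image (hk k)

/-- The map `T(μ) = ∫ r(dω) T_{γ[ω]}(μ)` on probability measures. -/
noncomputable def T (D : RandomMap Ω S) (r : ProbabilityMeasure Ω)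
    (μ : ProbabilityMeasure S) : ProbabilityMeasure S :=
  ⟨(r : Measure Ω).bind fun ω => (mapT (D.eval ω) (D.measurable_eval ω) μ : Measure S), by
    have hm : Measurable fun ω => (mapT (D.eval ω) (D.measurable_eval ω) μ : Measure S) :=
      measurable_subtype_coe.comp (D.measurable_mapT_eval μ)
    refine ⟨?_⟩
    rw [Measure.bind_apply MeasurableSet.univ hm.aemeasurable]
    simp⟩

/-- The higher-level map `Ť(ρ) = ∫ r(dω) T_{γ̌[ω]}(ρ)`. -/
noncomputable def higherT (D : RandomMap Ω S) (r : ProbabilityMeasure Ω) :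
    ProbabilityMeasure (ProbabilityMeasure S) → ProbabilityMeasure (ProbabilityMeasure S) :=
  D.check.T r

end RandomMap

/-! ### Laws of random probability measures and the convex order -/

section ConvexOrder

variable {S : Type u} [MeasurableSpace S]

/-- The first moment measure `ρ⁽¹⁾ = ∫ ρ(dξ) ξ`. -/
noncomputable def firstMoment (ρ : ProbabilityMeasure (ProbabilityMeasure S)) :
    ProbabilityMeasure S :=
  ⟨(ρ : Measure (ProbabilityMeasure S)).bind fun ξ => (ξ : Measure S), by
    refine ⟨?_⟩
    have hm : Measurable fun ξ : ProbabilityMeasure S => (ξ : Measure S) :=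
      measurable_subtype_coe
    rw [Measure.bind_apply MeasurableSet.univ hm.aemeasurable]
    simp⟩

/-- The set of all `ρ` whose first moment measure is `μ`. -/
def lawsWithMean (μ : ProbabilityMeasure S) : Set (ProbabilityMeasure (ProbabilityMeasure S)) :=
  {ρ | firstMoment ρ = μ}

/-- The law of the random probability measure `δ_X`, where `X` has law `μ`. -/
noncomputable def diracLaw (μ : ProbabilityMeasure S) :
    ProbabilityMeasure (ProbabilityMeasure S) :=
  μ.map (f := fun x : S => diracProba x)
    (Measurable.subtype_mk Measure.measurable_dirac).aemeasurable

/-- `ξ` is a (regular) conditional law `P[X ∈ · | m]` of `X` given the sub-σ-field `m`. -/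
def IsCondLaw {E : Type u} {F : MeasurableSpace E} (P : Measure E) (m : MeasurableSpace E)
    (X : E → S) (ξ : E → ProbabilityMeasure S) : Prop :=
  Measurable[m] ξ ∧ ∀ A : Set S, MeasurableSet A →
    (fun e => (ξ e : Measure S).real A) =ᵐ[P] P[(X ⁻¹' A).indicator fun _ => (1 : ℝ) | m]

/-- The convex order: `ρ₁ ≤_cv ρ₂` if there are a random variable `X` on some probability space
`(E, F, P)` and sub-σ-fields `F₁ ⊆ F₂ ⊆ F` such that `ρᵢ` is the law of `P[X ∈ · | Fᵢ]`. -/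
def ConvexLE (ρ₁ ρ₂ : ProbabilityMeasure (ProbabilityMeasure S)) : Prop :=
  ∃ (E : Type u) (F₁ F₂ F : MeasurableSpace E) (P : Measure E)
    (X : E → S) (ξ₁ ξ₂ : E → ProbabilityMeasure S),
    IsProbabilityMeasure P ∧ F₁ ≤ F₂ ∧ F₂ ≤ F ∧ Measurable[F] X ∧
    IsCondLaw P F₁ X ξ₁ ∧ IsCondLaw P F₂ X ξ₂ ∧
    P.map ξ₁ = (ρ₁ : Measure (ProbabilityMeasure S)) ∧
    P.map ξ₂ = (ρ₂ : Measure (ProbabilityMeasure S))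

end ConvexOrder

/-! ### The σ-field on the space of probability measures -/

section Borel

variable {S : Type u} [TopologicalSpace S] [PolishSpace S] [MeasurableSpace S] [BorelSpace S]

theorem isOpen_lt_measure {G : Set S} (hG : IsOpen G) (c : NNReal) :
    IsOpen {ν : ProbabilityMeasure S | c < ν G} := by
  rw [isOpen_iff_mem_nhds]
  intro ν (hν : c < ν G)
  have h1 : (ν : Measure S) G ≤ (𝓝 ν).liminf fun ν' : ProbabilityMeasure S => (ν' : Measure S) G := by
    let _ : MetricSpace S := TopologicalSpace.metrizableSpaceMetric S
    exact ProbabilityMeasure.le_liminf_measure_open_of_tendsto tendsto_id hG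
  have h2 : (c : ENNReal) < (ν : Measure S) G := by
    rw [← ProbabilityMeasure.ennreal_coeFn_eq_coeFn_toMeasure]
    exact_mod_cast hν
  filter_upwards [Filter.eventually_lt_of_lt_liminf (lt_of_lt_of_le h2 h1)] with ν' h'
  rw [← ProbabilityMeasure.ennreal_coeFn_eq_coeFn_toMeasure] at h'
  exact_mod_cast h'

/-- A countable subbasis of the topology of weak convergence. -/
def weakSubbasis (S : Type u) [TopologicalSpace S] [PolishSpace S] [MeasurableSpace S]
    [BorelSpace S] : Set (Set (ProbabilityMeasure S)) :=
  {U | ∃ s : Set (Set S), s.Finite ∧ s ⊆ TopologicalSpace.countableBasis S ∧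
    ∃ q : ℚ, U = {ν : ProbabilityMeasure S | Real.toNNReal q < ν (⋃₀ s)}}

theorem countable_weakSubbasis : (weakSubbasis S).Countable := by
  have h1 := Set.countable_ofPred_finite_subset (TopologicalSpace.countable_countableBasis S)
  have h2 := (h1.prod (Set.countable_univ : (Set.univ : Set ℚ).Countable)).image
    fun p : Set (Set S) × ℚ => {ν : ProbabilityMeasure S | Real.toNNReal p.2 < ν (⋃₀ p.1)}
  refine h2.mono ?_
  rintro U ⟨s, hs, hsB, q, rfl⟩
  exact ⟨(s, q), ⟨⟨hs, hsB⟩, Set.mem_univ _⟩, rfl⟩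

theorem isOpen_sUnion_of_subset {S : Type u} [TopologicalSpace S] [PolishSpace S] {s : Set (Set S)}
    (hs : s ⊆ TopologicalSpace.countableBasis S) : IsOpen (⋃₀ s) :=
  isOpen_sUnion fun _ h => TopologicalSpace.isOpen_of_mem_countableBasis (hs h)

theorem exists_finite_subset_lt {S : Type u} [TopologicalSpace S] [PolishSpace S]
    [MeasurableSpace S] (ν : ProbabilityMeasure S) {G : Set S} (hG : IsOpen G)
    {c : NNReal} (hc : c < ν G) :
    ∃ s : Set (Set S), s.Finite ∧ s ⊆ TopologicalSpace.countableBasis S ∧ ⋃₀ s ⊆ G ∧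
      c < ν (⋃₀ s) := by
  obtain ⟨s, hsB, rfl⟩ := (TopologicalSpace.isBasis_countableBasis S).open_eq_sUnion hG
  have hsc : s.Countable := (TopologicalSpace.countable_countableBasis S).mono hsB
  rcases s.eq_empty_or_nonempty with rfl | hne
  · simp at hc
  obtain ⟨f, rfl⟩ := hsc.exists_eq_range hne
  have ht : Tendsto (fun n => (ν : Measure S) (⋃ i ∈ Set.Iic n, f i)) atTop
      (𝓝 ((ν : Measure S) (⋃ n, ⋃ i ∈ Set.Iic n, f i))) :=
    tendsto_measure_iUnion_atTop fun m n hmn =>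
      Set.biUnion_subset_biUnion_left (Set.Iic_subset_Iic.2 hmn)
  have hU : (⋃ n : ℕ, ⋃ i ∈ Set.Iic n, f i) = ⋃₀ Set.range f := by
    ext x
    simp only [Set.mem_iUnion, Set.mem_Iic, Set.sUnion_range]
    exact ⟨fun ⟨_, i, _, h⟩ => ⟨i, h⟩, fun ⟨i, h⟩ => ⟨i, i, le_rfl, h⟩⟩
  rw [hU] at ht
  have h2 : (c : ENNReal) < (ν : Measure S) (⋃₀ Set.range f) := by
    rw [← ProbabilityMeasure.ennreal_coeFn_eq_coeFn_toMeasure]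
    exact_mod_cast hc
  obtain ⟨n, hn⟩ := (ht.eventually (lt_mem_nhds h2)).exists
  refine ⟨f '' Set.Iic n, (Set.finite_Iic n).image f,
    (Set.image_subset_range _ _).trans hsB, Set.sUnion_mono (Set.image_subset_range _ _), ?_⟩
  rw [← ProbabilityMeasure.ennreal_coeFn_eq_coeFn_toMeasure] at hn
  rw [Set.sUnion_image]
  exact_mod_cast hn

theorem le_nhds_of_weakSubbasis (ν : ProbabilityMeasure S) (L : Filter (ProbabilityMeasure S))
    [L.IsCountablyGenerated] (hL : ∀ U ∈ weakSubbasis S, ν ∈ U → U ∈ L) : L ≤ 𝓝 ν := by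
  rcases L.eq_or_neBot with rfl | hne
  · exact bot_le
  refine tendsto_of_forall_isOpen_le_liminf (μs := fun ν' => ν') fun G hG => ?_
  refine le_of_forall_lt fun c hc => ?_
  obtain ⟨c', hcc', hc'⟩ := exists_between hc
  obtain ⟨q, hq1, hq2⟩ := exists_rat_btwn (NNReal.coe_lt_coe.2 hc')
  have hq0 : (0 : ℝ) ≤ q := c'.coe_nonneg.trans hq1.le
  obtain ⟨s, hs, hsB, hsG, hlt⟩ := exists_finite_subset_lt ν hG
    (c := Real.toNNReal q) ((Real.toNNReal_lt_iff_lt_coe hq0).2 hq2)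
  have hmem : {ν' : ProbabilityMeasure S | Real.toNNReal q < ν' (⋃₀ s)} ∈ L :=
    hL _ ⟨s, hs, hsB, q, rfl⟩ hlt
  refine lt_of_lt_of_le hcc' (le_liminf_of_le ?_ ?_)
  · exact (isBoundedUnder_of ⟨1, by simp⟩).isCoboundedUnder_ge
  · filter_upwards [hmem] with ν' h'
    have h'' : c' < Real.toNNReal q := by
      rw [Real.lt_toNNReal_iff_coe_lt]
      exact hq1
    exact (h''.trans h').le.trans (ProbabilityMeasure.apply_mono ν' hsG)

theorem weak_eq_generateFrom :
    (inferInstance : TopologicalSpace (ProbabilityMeasure S))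
      = TopologicalSpace.generateFrom (weakSubbasis S) := by
  refine le_antisymm ?_ ?_
  · refine le_generateFrom ?_
    rintro U ⟨s, hs, hsB, q, rfl⟩
    exact isOpen_lt_measure (isOpen_sUnion_of_subset hsB) _
  · refine le_of_nhds_le_nhds fun ν => ?_
    have h : (@nhds _ (TopologicalSpace.generateFrom (weakSubbasis S)) ν).IsCountablyGenerated :=
      @FirstCountableTopology.nhds_generated_countable _
        (TopologicalSpace.generateFrom (weakSubbasis S))
        (@TopologicalSpace.SecondCountableTopology.to_firstCountableTopology _
          (TopologicalSpace.generateFrom (weakSubbasis S))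
          (@SecondCountableTopology.mk _ (TopologicalSpace.generateFrom (weakSubbasis S))
            ⟨weakSubbasis S, countable_weakSubbasis, rfl⟩)) ν
    exact le_nhds_of_weakSubbasis ν _ fun U hU hν =>
      @IsOpen.mem_nhds _ (TopologicalSpace.generateFrom (weakSubbasis S)) _ _
        (TopologicalSpace.isOpen_generateFrom_of_mem hU) hν

/-- On a Polish space, the σ-field on probability measures generated by the evaluations
`ν ↦ ν A` is the Borel σ-field of the topology of weak convergence. -/
instance instBorelSpaceProbabilityMeasure : BorelSpace (ProbabilityMeasure S) := by
  have : SecondCountableTopology (ProbabilityMeasure S) :=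
    ⟨⟨weakSubbasis S, countable_weakSubbasis, weak_eq_generateFrom⟩⟩
  have hlt : ∀ (m : MeasurableSpace (ProbabilityMeasure S)) (G : Set S),
      (@Measurable _ _ m _ fun ν : ProbabilityMeasure S => (ν : Measure S) G) →
      ∀ c : NNReal, MeasurableSet[m] {ν : ProbabilityMeasure S | c < ν G} := by
    intro m G h c
    have h' := h (measurableSet_Ioi (a := (c : ENNReal)))
    convert h' using 1
    ext ν
    simp only [Set.mem_ofPred_eq, Set.mem_preimage, Set.mem_Ioi]
    rw [← ProbabilityMeasure.ennreal_coeFn_eq_coeFn_toMeasure]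
    norm_cast
  refine ⟨le_antisymm ?_ ?_⟩
  · have hid : @Measurable _ _ (borel (ProbabilityMeasure S)) _
        fun ν : ProbabilityMeasure S => (ν : Measure S) := by
      let _ : MeasurableSpace (ProbabilityMeasure S) := borel _
      refine Measurable.measure_of_isPiSystem_of_isProbabilityMeasure
        (S := {G : Set S | IsOpen G}) (BorelSpace.measurable_eq) isPiSystem_isOpen ?_
      intro G hG
      refine measurable_of_Ioi fun c => ?_
      induction c using ENNReal.recTopCoe with
      | top => simp
      | coe c =>
        have : IsOpen ((fun ν : ProbabilityMeasure S => (ν : Measure S) G) ⁻¹'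
            Set.Ioi (c : ENNReal)) := by
          convert isOpen_lt_measure hG c using 1
          ext ν
          simp only [Set.mem_ofPred_eq, Set.mem_preimage, Set.mem_Ioi]
          rw [← ProbabilityMeasure.ennreal_coeFn_eq_coeFn_toMeasure]
          norm_cast
        exact MeasurableSpace.measurableSet_generateFrom this
    exact hid.comap_le
  · rw [borel_eq_generateFrom_of_subbasis weak_eq_generateFrom]
    refine MeasurableSpace.generateFrom_le ?_
    rintro U ⟨s, hs, hsB, q, rfl⟩
    exact hlt _ _ ((Measure.measurable_coe
      (isOpen_sUnion_of_subset hsB).measurableSet).comp measurable_subtype_coe) _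

end Borel

end HigherRDE

/-!
Everything is expressed through martingale couplings: laws `Q` of pairs `(ξ₁, ξ₂)` of random
probability measures with `E[ξ₂ | ξ₁] = ξ₁`. One has `ρ₁ ≤ ρ₂` in the convex order if and only if
there is a martingale coupling with marginals `ρ₁` and `ρ₂` (`convexLE_iff`). This form of the
order needs no probability space and is written as an equality of two mixtures, so that it is
visibly compatible with independent copies and with weak limits.

*Monotonicity.* Independent copies of a martingale coupling, with `ǧ` applied to both components,
form again a martingale coupling (`IsMartingaleCoupling.mapT`), because products of mixtures are
mixtures of products (`mixture_infProd`). Mixing over `ω` gives `ConvexLE.higherT`. The same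
interchange shows that the mean of `Ť ρ` is `T` of the mean of `ρ`
(`RandomMap.firstMoment_higherT`). Dirac measures are intertwined by
`ǧ (δ_{x₁}, δ_{x₂}, …) = δ_{g x}`, so the law of `δ_X` is mapped to the law of `δ_Y` with `Y` of law `T μ`
(`RandomMap.higherT_diracLaw`).

*Convergence.* Every `ρ` with mean `μ` lies between `δ_μ` and the law of `δ_X`, where `X` has law
`μ` (`convexLE_of_firstMoment`, `convexLE_diracLaw`). Hence the iterates of `Ť` started in `δ_μ`
increase and lie below every fixed point with mean `μ`. The laws with mean `μ` form a weakly
compact set (`isCompact_lawsWithMean`, Prokhorov's theorem and Markov's inequality), on which the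
convex order is closed (`isClosed_convexLE`) and antisymmetric (`ConvexLE.antisymm`, by comparing
the second moments of `ξ(A)`). Therefore increasing sequences converge
(`exists_tendsto_of_convexLE`).

*The limit is a fixed point.* Since `γ` is merely measurable, `Ť` need not be weakly continuous.
However, along martingale couplings of the iterates `ξ_t` with the limit `ξ`, second moments
converge, so that `E|∫ f dξ_t - ∫ f dξ| → 0` for bounded continuous `f`. As all means are equal to
`μ`, this extends to `E|ξ_t(A) - ξ(A)| → 0` for all Borel sets `A`
(`IsMartingaleCoupling.tendsto_meanDev`). This mode of convergence passes to i.i.d. products by a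
π-λ argument, and from there to measurable images and hence through `Ť`
(`tendsto_meanDev_infProd`, `tendsto_meanDev_square_T`). So the second moments of `Ť` of the limit
agree with those of the limit, and as one lies below the other, they are equal
(`ConvexLE.eq_of_integral_sq_le`, `higherT_eq_of_tendsto`).
-/

namespace HigherRDE

/-! ### Mixtures of probability measures -/

section Mixture

variable {Z Y W : Type*} {mZ : MeasurableSpace Z} [MeasurableSpace Y] [MeasurableSpace W]

/-- The mixture `∫ Q(dz) K z` of a measurable family of probability measures. -/
noncomputable def mixture (Q : ProbabilityMeasure Z) (K : Z → ProbabilityMeasure Y)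
    (hK : Measurable K) : ProbabilityMeasure Y :=
  ⟨(Q : Measure Z).bind fun z => (K z : Measure Y),
    isProbabilityMeasure_bind (measurable_subtype_coe.comp hK).aemeasurable
      (ae_of_all _ fun z => inferInstanceAs (IsProbabilityMeasure (K z : Measure Y)))⟩

theorem measurable_coe_measure {K : Z → ProbabilityMeasure Y} (hK : Measurable K) {A : Set Y}
    (hA : MeasurableSet A) : Measurable fun z => (K z : Measure Y) A :=
  (Measure.measurable_coe hA).comp (measurable_subtype_coe.comp hK)

theorem measurable_real {K : Z → ProbabilityMeasure Y} (hK : Measurable K) {A : Set Y}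
    (hA : MeasurableSet A) : Measurable fun z => (K z : Measure Y).real A :=
  (measurable_coe_measure hK hA).ennreal_toReal

theorem measurable_map_probabilityMeasure {φ : Y → W} (hφ : Measurable φ) :
    Measurable fun ν : ProbabilityMeasure Y => ν.map hφ.aemeasurable :=
  Measurable.subtype_mk ((Measure.measurable_map φ hφ).comp measurable_subtype_coe)

theorem measurable_diracProba : Measurable fun y : Y => diracProba y :=
  Measurable.subtype_mk Measure.measurable_dirac

theorem mixture_apply (Q : ProbabilityMeasure Z) {K : Z → ProbabilityMeasure Y}
    (hK : Measurable K) {A : Set Y} (hA : MeasurableSet A) :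
    (mixture Q K hK : Measure Y) A = ∫⁻ z, (K z : Measure Y) A ∂(Q : Measure Z) :=
  Measure.bind_apply hA (measurable_subtype_coe.comp hK).aemeasurable

theorem lintegral_mixture (Q : ProbabilityMeasure Z) {K : Z → ProbabilityMeasure Y}
    (hK : Measurable K) {f : Y → ENNReal} (hf : Measurable f) :
    ∫⁻ y, f y ∂(mixture Q K hK : Measure Y)
      = ∫⁻ z, ∫⁻ y, f y ∂(K z : Measure Y) ∂(Q : Measure Z) :=
  Measure.lintegral_bind (measurable_subtype_coe.comp hK).aemeasurable hf.aemeasurable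

theorem integrable_of_bounded {P : Measure Z} [IsFiniteMeasure P] {f : Z → ℝ} (hf : Measurable f)
    {C : ℝ} (hC : ∀ z, |f z| ≤ C) : Integrable f P :=
  Integrable.of_bound hf.aestronglyMeasurable C (ae_of_all _ hC)

theorem integral_mixture (Q : ProbabilityMeasure Z) {K : Z → ProbabilityMeasure Y}
    (hK : Measurable K) {f : Y → ℝ} (hf : Measurable f) {C : ℝ} (hC : ∀ y, |f y| ≤ C) :
    ∫ y, f y ∂(mixture Q K hK : Measure Y)
      = ∫ z, ∫ y, f y ∂(K z : Measure Y) ∂(Q : Measure Z) := by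
  let κ : ProbabilityTheory.Kernel Z Y :=
    ⟨fun z => (K z : Measure Y), measurable_subtype_coe.comp hK⟩
  have : ProbabilityTheory.IsMarkovKernel κ :=
    ⟨fun z => inferInstanceAs (IsProbabilityMeasure (K z : Measure Y))⟩
  have h1 : (mixture Q K hK : Measure Y) = ((Q : Measure Z).compProd κ).snd := by
    rw [Measure.snd_compProd]; rfl
  rw [h1, Measure.snd, integral_map measurable_snd.aemeasurable hf.aestronglyMeasurable,
    Measure.integral_compProd]
  · rfl
  · exact integrable_of_bounded (hf.comp measurable_snd) fun z => hC _

theorem map_mixture (Q : ProbabilityMeasure Z) {K : Z → ProbabilityMeasure Y}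
    (hK : Measurable K) {φ : Y → W} (hφ : Measurable φ) :
    (mixture Q K hK).map hφ.aemeasurable
      = mixture Q (fun z => (K z).map hφ.aemeasurable)
        ((measurable_map_probabilityMeasure hφ).comp hK) := by
  refine Subtype.ext (Measure.ext fun A hA => ?_)
  refine (Measure.map_apply hφ hA).trans ?_
  refine (mixture_apply Q hK (hφ hA)).trans ?_
  refine Eq.trans ?_ (mixture_apply Q _ hA).symm
  exact lintegral_congr fun z => (Measure.map_apply hφ hA).symm

theorem mixture_map (Q : ProbabilityMeasure W) {φ : W → Z} (hφ : Measurable φ)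
    {K : Z → ProbabilityMeasure Y} (hK : Measurable K) :
    mixture (Q.map hφ.aemeasurable) K hK = mixture Q (fun w => K (φ w)) (hK.comp hφ) := by
  refine Subtype.ext (Measure.ext fun A hA => ?_)
  refine (mixture_apply _ hK hA).trans ?_
  refine Eq.trans ?_ (mixture_apply Q _ hA).symm
  exact lintegral_map (measurable_coe_measure hK hA) hφ

theorem mixture_congr (Q : ProbabilityMeasure Z) {K L : Z → ProbabilityMeasure Y}
    (hK : Measurable K) (hL : Measurable L) (h : ∀ z, K z = L z) :
    mixture Q K hK = mixture Q L hL := by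
  obtain rfl : K = L := funext h
  rfl

theorem mixture_diracProba (Q : ProbabilityMeasure Z) :
    mixture Q (fun z => diracProba z) measurable_diracProba = Q :=
  Subtype.ext Measure.bind_dirac

theorem mixture_mixture (Q : ProbabilityMeasure Z) {K : Z → ProbabilityMeasure W}
    (hK : Measurable K) {L : W → ProbabilityMeasure Y} (hL : Measurable L)
    (hKL : Measurable fun z => mixture (K z) L hL) :
    mixture (mixture Q K hK) L hL = mixture Q (fun z => mixture (K z) L hL) hKL := by
  refine Subtype.ext (Measure.ext fun A hA => ?_)
  refine (mixture_apply _ hL hA).trans ?_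
  refine Eq.trans ?_ (mixture_apply Q _ hA).symm
  refine (lintegral_mixture Q hK (measurable_coe_measure hL hA)).trans ?_
  exact lintegral_congr fun z => (mixture_apply (K z) hL hA).symm

theorem measurable_mixture {K : Z → ProbabilityMeasure W} (hK : Measurable K)
    {L : W → ProbabilityMeasure Y} (hL : Measurable L) :
    Measurable fun z => mixture (K z) L hL :=
  Measurable.subtype_mk ((Measure.measurable_bind' (measurable_subtype_coe.comp hL)).comp
    (measurable_subtype_coe.comp hK))

end Mixture

theorem continuous_mixture {Z Y : Type*} [MeasurableSpace Z] [TopologicalSpace Z]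
    [OpensMeasurableSpace Z] [MeasurableSpace Y] [TopologicalSpace Y] [OpensMeasurableSpace Y]
    {K : Z → ProbabilityMeasure Y} (hK : Measurable K) (hKc : Continuous K) :
    Continuous fun Q : ProbabilityMeasure Z => mixture Q K hK := by
  rw [ProbabilityMeasure.continuous_iff_forall_continuous_integral]
  intro f
  have hc : Continuous fun z => ∫ y, f y ∂(K z : Measure Y) :=
    (ProbabilityMeasure.continuous_integral_boundedContinuousFunction f).comp hKc
  have hb : ∀ z, ‖∫ y, f y ∂(K z : Measure Y)‖ ≤ ‖f‖ := fun z => by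
    simpa using norm_integral_le_of_norm_le_const (μ := (K z : Measure Y))
      (ae_of_all _ fun y => f.norm_coe_le_norm y)
  have h := ProbabilityMeasure.continuous_integral_boundedContinuousFunction
    (BoundedContinuousFunction.ofNormedAddCommGroup _ hc ‖f‖ hb)
  refine h.congr fun Q => ?_
  exact (integral_mixture Q hK f.continuous.measurable
    fun y => f.norm_coe_le_norm y).symm

/-! ### Products of probability measures -/

section Product

variable {X Y : Type*} [MeasurableSpace X] [MeasurableSpace Y]

/-- The product `⨂ᵢ ν i`, as a probability measure. -/
noncomputable def infProd {ι : Type} (ν : ι → ProbabilityMeasure X) : ProbabilityMeasure (ι → X) :=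
  ⟨Measure.infinitePi fun i => (ν i : Measure X), inferInstance⟩

theorem measurable_infProd (ι : Type) :
    Measurable fun ν : ι → ProbabilityMeasure X => infProd ν :=
  Measurable.subtype_mk (measurable_infinitePi ι)

theorem measurable_infProd_comp {ι : Type} {K : X → ProbabilityMeasure Y} (hK : Measurable K) :
    Measurable fun x : ι → X => infProd fun i => K (x i) :=
  (measurable_infProd ι).comp
    (measurable_pi_lambda _ fun i => hK.comp (measurable_pi_apply i))

theorem checkMap_eq_map {ι : Type} (g : (ι → X) → X) (hg : Measurable g)
    (ν : ι → ProbabilityMeasure X) : checkMap g hg ν = (infProd ν).map hg.aemeasurable :=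
  rfl

theorem infProd_map {ι : Type} (ν : ι → ProbabilityMeasure X) {f : ι → X → Y}
    (hf : ∀ i, Measurable (f i)) :
    (infProd ν).map (f := fun x i => f i (x i))
        (measurable_pi_lambda _ fun i => (hf i).comp (measurable_pi_apply i)).aemeasurable
      = infProd fun i => (ν i).map (hf i).aemeasurable :=
  Subtype.ext (Measure.infinitePi_map_pi _ hf)

theorem infProd_map_eval {ι : Type} (ν : ι → ProbabilityMeasure X) (i : ι) :
    (infProd ν).map (f := fun x => x i) (measurable_pi_apply i).aemeasurable = ν i :=
  Subtype.ext (Measure.infinitePi_map_eval _ i)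

theorem infProd_diracProba {ι : Type} (x : ι → X) :
    (infProd fun i => diracProba (x i)) = diracProba x :=
  Subtype.ext (Measure.infinitePi_dirac x)

/-- Mixing independently in each coordinate: the mixture of the products `⨂ᵢ K (x i)` over an
i.i.d. sequence `x` is the product of the mixtures. -/
theorem mixture_infProd {ι : Type} (Q : ProbabilityMeasure X) {K : X → ProbabilityMeasure Y}
    (hK : Measurable K) :
    mixture (infProd fun _ : ι => Q) (fun x => infProd fun i => K (x i))
        (measurable_infProd_comp hK)
      = infProd fun _ : ι => mixture Q K hK := by
  refine Subtype.ext ?_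
  refine Measure.eq_infinitePi _ fun s t ht => ?_
  refine (mixture_apply _ _ (.pi s.countable_toSet fun i _ => ht i)).trans ?_
  have h1 : ∀ x : ι → X, (infProd (fun i => K (x i)) : Measure (ι → Y)) ((s : Set ι).pi t)
      = ∏ i ∈ s, (K (x i) : Measure Y) (t i) := fun x =>
    Measure.infinitePi_pi _ fun i _ => ht i
  simp_rw [h1]
  have hm : ∀ i, Measurable fun x : X => (K x : Measure Y) (t i) := fun i =>
    measurable_coe_measure hK (ht i)
  refine (ProbabilityTheory.lintegral_prod_eq_prod_lintegral_of_indepFun s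
    (fun i (x : ι → X) => (K (x i) : Measure Y) (t i))
    (ProbabilityTheory.iIndepFun_infinitePi (X := fun i x => (K x : Measure Y) (t i)) hm)
    fun i => (hm i).comp (measurable_pi_apply i)).trans ?_
  refine Finset.prod_congr rfl fun i _ => ?_
  have h2 := lintegral_map (μ := Measure.infinitePi fun _ : ι => (Q : Measure X)) (hm i)
    (measurable_pi_apply i)
  rw [Measure.infinitePi_map_eval] at h2
  exact h2.symm.trans (mixture_apply Q hK (ht i)).symm

end Product

/-! ### Martingale couplings and the convex order -/

section Coupling

variable {S : Type u} [MeasurableSpace S]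

/-- The law of `(ξ, x)` where `ξ` is fixed and `x` has law `ζ`. -/
noncomputable def tag (ξ ζ : ProbabilityMeasure S) :
    ProbabilityMeasure (ProbabilityMeasure S × S) :=
  (diracProba ξ).prod ζ

theorem measurable_tag :
    Measurable fun z : ProbabilityMeasure S × ProbabilityMeasure S => tag z.1 z.2 :=
  Measurable.subtype_mk (ProbabilityMeasure.measurable_fun_prod.comp
    ((measurable_diracProba.comp measurable_fst).prodMk measurable_snd))

theorem measurable_tag_comp {Z : Type*} [MeasurableSpace Z] {f g : Z → ProbabilityMeasure S}
    (hf : Measurable f) (hg : Measurable g) : Measurable fun z => tag (f z) (g z) :=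
  (Measurable.comp (g := fun z : _ × _ => tag z.1 z.2) measurable_tag (hf.prodMk hg) :)

theorem measurable_tag_self :
    Measurable fun z : ProbabilityMeasure S × ProbabilityMeasure S => tag z.1 z.1 :=
  measurable_tag_comp measurable_fst measurable_fst

theorem tag_eq_map (ξ ζ : ProbabilityMeasure S) :
    tag ξ ζ = ζ.map (f := Prod.mk ξ) measurable_prodMk_left.aemeasurable :=
  Subtype.ext (Measure.dirac_prod ξ)

theorem tag_apply_prod (ξ ζ : ProbabilityMeasure S) {B : Set (ProbabilityMeasure S)} {A : Set S}
    (hB : MeasurableSet B) :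
    (tag ξ ζ : Measure (ProbabilityMeasure S × S)) (B ×ˢ A)
      = B.indicator (fun _ => (ζ : Measure S) A) ξ := by
  refine (Measure.prod_prod _ _).trans ?_
  rw [diracProba_toMeasure_apply' ξ hB]
  by_cases h : ξ ∈ B <;> simp [h]

/-- The law `Q` of a pair of random probability measures `(ξ₁, ξ₂)` is a martingale coupling if,
with `xᵢ` sampled from `ξᵢ`, the pairs `(ξ₁, x₁)` and `(ξ₁, x₂)` have the same law; that is, if
`E[ξ₂ | ξ₁] = ξ₁`. -/
def IsMartingaleCoupling (Q : ProbabilityMeasure (ProbabilityMeasure S × ProbabilityMeasure S)) :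
    Prop :=
  mixture Q (fun z => tag z.1 z.1) measurable_tag_self
    = mixture Q (fun z => tag z.1 z.2) measurable_tag

theorem mixture_tag_prod (Q : ProbabilityMeasure (ProbabilityMeasure S × ProbabilityMeasure S))
    {B : Set (ProbabilityMeasure S)} {A : Set S} (hB : MeasurableSet B) (hA : MeasurableSet A) :
    (mixture Q (fun z => tag z.1 z.2) measurable_tag : Measure (ProbabilityMeasure S × S)) (B ×ˢ A)
      = ∫⁻ z in Prod.fst ⁻¹' B, (z.2 : Measure S) A ∂Q.toMeasure := by
  rw [mixture_apply _ _ (hB.prod hA), ← lintegral_indicator (measurable_fst hB)]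
  refine lintegral_congr fun z => ?_
  rw [tag_apply_prod _ _ hB]
  rfl

theorem mixture_tag_self_prod
    (Q : ProbabilityMeasure (ProbabilityMeasure S × ProbabilityMeasure S))
    {B : Set (ProbabilityMeasure S)} {A : Set S} (hB : MeasurableSet B) (hA : MeasurableSet A) :
    (mixture Q (fun z => tag z.1 z.1) measurable_tag_self :
        Measure (ProbabilityMeasure S × S)) (B ×ˢ A)
      = ∫⁻ z in Prod.fst ⁻¹' B, (z.1 : Measure S) A ∂Q.toMeasure := by
  rw [mixture_apply _ _ (hB.prod hA), ← lintegral_indicator (measurable_fst hB)]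
  refine lintegral_congr fun z => ?_
  rw [tag_apply_prod _ _ hB]
  rfl

/-- Rectangles determine the laws of `(ξ₁, x₁)` and `(ξ₁, x₂)`, so the martingale property can be
tested on the events `{ξ₁ ∈ B}`. -/
theorem isMartingaleCoupling_iff
    {Q : ProbabilityMeasure (ProbabilityMeasure S × ProbabilityMeasure S)} :
    IsMartingaleCoupling Q ↔ ∀ (B : Set (ProbabilityMeasure S)) (A : Set S),
      MeasurableSet B → MeasurableSet A →
        ∫⁻ z in Prod.fst ⁻¹' B, (z.1 : Measure S) A ∂Q.toMeasure
          = ∫⁻ z in Prod.fst ⁻¹' B, (z.2 : Measure S) A ∂Q.toMeasure := by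
  constructor
  · intro h B A hB hA
    rw [← mixture_tag_prod Q hB hA, ← mixture_tag_self_prod Q hB hA, h]
  · intro h
    refine ProbabilityMeasure.toMeasure_injective (Measure.ext_prod fun {B A} hB hA => ?_)
    refine (mixture_tag_self_prod Q hB hA).trans ?_
    rw [h B A hB hA, ← mixture_tag_prod Q hB hA]

/-- A `m`-measurable random measure is the conditional law of `X` given `m` exactly if its integrals
over the sets in `m` are right; this avoids conditional expectations, which are only determined
almost everywhere. -/
theorem isCondLaw_iff {E : Type u} {m F : MeasurableSpace E} (P : Measure E)
    [IsProbabilityMeasure P] (hm : m ≤ F) {X : E → S} (hX : Measurable X)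
    {ξ : E → ProbabilityMeasure S} (hξ : Measurable[m] ξ) :
    IsCondLaw P m X ξ ↔ ∀ s, MeasurableSet[m] s → ∀ A, MeasurableSet A →
      ∫⁻ e in s, (ξ e : Measure S) A ∂P = P (s ∩ X ⁻¹' A) := by
  have hr : ∀ A, MeasurableSet A → Measurable[m] fun e => (ξ e : Measure S).real A := fun A hA =>
    measurable_real hξ hA
  have hi : ∀ A, MeasurableSet A → Integrable (fun e => (ξ e : Measure S).real A) P := fun A hA =>
    integrable_of_bounded ((hr A hA).mono hm le_rfl) (C := 1) fun e => by
      rw [abs_of_nonneg measureReal_nonneg]; exact measureReal_le_one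
  have hind : ∀ A, MeasurableSet A → Integrable ((X ⁻¹' A).indicator fun _ => (1 : ℝ)) P :=
    fun A hA => (integrable_const 1).indicator (hX hA)
  -- the integral identity in terms of real numbers
  have key : ∀ s, MeasurableSet[m] s → ∀ A, MeasurableSet A →
      (∫⁻ e in s, (ξ e : Measure S) A ∂P = P (s ∩ X ⁻¹' A) ↔
        ∫ e in s, (ξ e : Measure S).real A ∂P
          = ∫ e in s, (X ⁻¹' A).indicator (fun _ => (1 : ℝ)) e ∂P) := by
    intro s hs A hA
    have h1 : ∫ e in s, (ξ e : Measure S).real A ∂P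
        = (∫⁻ e in s, (ξ e : Measure S) A ∂P).toReal :=
      integral_toReal (((measurable_coe_measure hξ hA).mono hm le_rfl).aemeasurable)
        (ae_of_all _ fun e => measure_lt_top _ _)
    have h2 : ∫ e in s, (X ⁻¹' A).indicator (fun _ => (1 : ℝ)) e ∂P
        = (P (s ∩ X ⁻¹' A)).toReal := by
      rw [integral_indicator (hX hA)]
      simp [Measure.real, Measure.restrict_apply (hX hA), Set.inter_comm]
    rw [h1, h2, ENNReal.toReal_eq_toReal_iff' ?_ (measure_ne_top _ _)]
    refine ne_of_lt (lt_of_le_of_lt (setLIntegral_le_lintegral _ _) ?_)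
    refine lt_of_le_of_lt (lintegral_mono (g := fun _ => 1) fun e => prob_le_one) ?_
    simp
  constructor
  · rintro ⟨-, h⟩ s hs A hA
    rw [key s hs A hA, ← setIntegral_condExp hm (hind A hA) hs]
    exact setIntegral_congr_ae (hm _ hs) ((h A hA).mono fun e he _ => he)
  · intro h
    refine ⟨hξ, fun A hA => ?_⟩
    exact ae_eq_condExp_of_forall_setIntegral_eq hm (hind A hA)
      (fun s _ _ => (hi A hA).integrableOn) (fun s hs _ => (key s hs A hA).1 (h s hs A hA))
      (hr A hA).stronglyMeasurable.aestronglyMeasurable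

/-- The convex order in terms of couplings. The conditional laws of some `X` given two nested
σ-fields form a martingale, and conversely, given a martingale coupling of `ξ₁` and `ξ₂`, one may
sample `X` from `ξ₂` and use the σ-fields generated by `ξ₁` and by `(ξ₁, ξ₂)`. -/
theorem convexLE_iff {ρ₁ ρ₂ : ProbabilityMeasure (ProbabilityMeasure S)} :
    ConvexLE ρ₁ ρ₂ ↔ ∃ Q : ProbabilityMeasure (ProbabilityMeasure S × ProbabilityMeasure S),
      IsMartingaleCoupling Q ∧ Q.map measurable_fst.aemeasurable = ρ₁ ∧
        Q.map measurable_snd.aemeasurable = ρ₂ := by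
  constructor
  · rintro ⟨E, F₁, F₂, F, P, X, ξ₁, ξ₂, hP, h12, h2, hX, hξ₁, hξ₂, hρ₁, hρ₂⟩
    have hm1 : Measurable[F] ξ₁ := hξ₁.1.mono (h12.trans h2) le_rfl
    have hm2 : Measurable[F] ξ₂ := hξ₂.1.mono h2 le_rfl
    have hm : Measurable[F] fun e => (ξ₁ e, ξ₂ e) := hm1.prodMk hm2
    refine ⟨ProbabilityMeasure.map (⟨P, hP⟩ : ProbabilityMeasure E) hm.aemeasurable, ?_, ?_, ?_⟩
    · refine isMartingaleCoupling_iff.2 fun B A hB hA => ?_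
      have hs : MeasurableSet[F₁] (ξ₁ ⁻¹' B) := hξ₁.1 hB
      have e1 := (isCondLaw_iff P (h12.trans h2) hX hξ₁.1).1 hξ₁ _ hs A hA
      have e2 := (isCondLaw_iff P h2 hX hξ₂.1).1 hξ₂ _ (h12 _ hs) A hA
      have t1 := setLIntegral_map (μ := P) (measurable_fst hB)
        (measurable_coe_measure measurable_fst hA) hm
      have t2 := setLIntegral_map (μ := P) (measurable_fst hB)
        (measurable_coe_measure measurable_snd hA) hm
      exact t1.trans ((e1.trans e2.symm).trans t2.symm)
    · exact Subtype.ext ((Measure.map_map measurable_fst hm).trans hρ₁)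
    · exact Subtype.ext ((Measure.map_map measurable_snd hm).trans hρ₂)
  · rintro ⟨Q, hQ, rfl, rfl⟩
    let κ : ProbabilityTheory.Kernel (ProbabilityMeasure S × ProbabilityMeasure S) S :=
      ⟨fun z => (z.2 : Measure S), measurable_subtype_coe.comp measurable_snd⟩
    have hκ : ProbabilityTheory.IsMarkovKernel κ :=
      ⟨fun z => inferInstanceAs (IsProbabilityMeasure (z.2 : Measure S))⟩
    let P := Q.toMeasure.compProd κ
    have hf : P.map Prod.fst = Q := Measure.fst_compProd _ _
    have hprod : ∀ (C : Set (ProbabilityMeasure S × ProbabilityMeasure S)) (A : Set S),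
        MeasurableSet C → MeasurableSet A →
          P (Prod.fst ⁻¹' C ∩ Prod.snd ⁻¹' A) = ∫⁻ z in C, (z.2 : Measure S) A ∂Q.toMeasure :=
      fun C A hC hA => Measure.compProd_apply_prod hC hA
    refine ⟨(ProbabilityMeasure S × ProbabilityMeasure S) × S,
      MeasurableSpace.comap (fun e => e.1.1) inferInstance,
      MeasurableSpace.comap Prod.fst inferInstance, inferInstance, P, Prod.snd,
      fun e => e.1.1, fun e => e.1.2, inferInstance, ?_, measurable_fst.comap_le, measurable_snd,
      ?_, ?_, ?_, ?_⟩
    · rintro _ ⟨B, hB, rfl⟩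
      exact ⟨Prod.fst ⁻¹' B, measurable_fst hB, rfl⟩
    · refine (isCondLaw_iff P measurable_fst.fst.comap_le measurable_snd
        (comap_measurable _)).2 ?_
      rintro _ ⟨B, hB, rfl⟩ A hA
      refine Eq.trans ?_ (hprod _ A (measurable_fst hB) hA).symm
      rw [← (isMartingaleCoupling_iff.1 hQ) B A hB hA, ← hf]
      exact (setLIntegral_map (measurable_fst hB) (measurable_coe_measure measurable_fst hA)
        measurable_fst).symm
    · refine (isCondLaw_iff P measurable_fst.comap_le measurable_snd
        (measurable_snd.comp (comap_measurable _))).2 ?_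
      rintro _ ⟨C, hC, rfl⟩ A hA
      refine Eq.trans ?_ (hprod _ A hC hA).symm
      rw [← hf]
      exact (setLIntegral_map hC (measurable_coe_measure measurable_snd hA) measurable_fst).symm
    · refine (Measure.map_map measurable_fst measurable_fst).symm.trans ?_
      rw [hf]; rfl
    · refine (Measure.map_map measurable_snd measurable_fst).symm.trans ?_
      rw [hf]; rfl

theorem IsMartingaleCoupling.convexLE
    {Q : ProbabilityMeasure (ProbabilityMeasure S × ProbabilityMeasure S)}
    (hQ : IsMartingaleCoupling Q) :
    ConvexLE (Q.map measurable_fst.aemeasurable) (Q.map measurable_snd.aemeasurable) :=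
  convexLE_iff.2 ⟨Q, hQ, rfl, rfl⟩

theorem firstMoment_eq_mixture (ρ : ProbabilityMeasure (ProbabilityMeasure S)) :
    firstMoment ρ = mixture ρ id measurable_id :=
  rfl

/-- Laws with a common mean `μ` lie above `δ_μ`: the coupling is the independent one. -/
theorem convexLE_of_firstMoment (ρ : ProbabilityMeasure (ProbabilityMeasure S)) :
    ConvexLE (diracProba (firstMoment ρ)) ρ := by
  refine convexLE_iff.2 ⟨(diracProba (firstMoment ρ)).prod ρ, ?_,
    ProbabilityMeasure.map_fst_prod _ _, ProbabilityMeasure.map_snd_prod _ _⟩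
  refine isMartingaleCoupling_iff.2 fun B A hB hA => ?_
  have hQ : ((diracProba (firstMoment ρ)).prod ρ).toMeasure
      = ρ.toMeasure.map (Prod.mk (firstMoment ρ)) := Measure.dirac_prod _
  rw [hQ, setLIntegral_map (measurable_fst hB) (measurable_coe_measure measurable_fst hA)
    measurable_prodMk_left, setLIntegral_map (measurable_fst hB)
    (measurable_coe_measure measurable_snd hA) measurable_prodMk_left]
  by_cases h : firstMoment ρ ∈ B
  · have : Prod.mk (firstMoment ρ) ⁻¹' (Prod.fst ⁻¹' B : Set (_ × ProbabilityMeasure S))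
        = Set.univ := by ext; simp [h]
    rw [this]
    have := mixture_apply ρ measurable_id hA
    simpa [firstMoment_eq_mixture] using this
  · have : Prod.mk (firstMoment ρ) ⁻¹' (Prod.fst ⁻¹' B : Set (_ × ProbabilityMeasure S))
        = ∅ := by ext; simp [h]
    simp [this]

/-- Laws with a common mean `μ` lie below `diracLaw μ`: given `ξ` with law `ρ`, sample `x` from
`ξ` and couple `ξ` to `δ_x`. -/
theorem convexLE_diracLaw (ρ : ProbabilityMeasure (ProbabilityMeasure S)) :
    ConvexLE ρ (diracLaw (firstMoment ρ)) := by
  have hφ : Measurable fun p : ProbabilityMeasure S × S => (p.1, diracProba p.2) :=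
    measurable_fst.prodMk (measurable_diracProba.comp measurable_snd)
  have htag : Measurable fun ξ : ProbabilityMeasure S => tag ξ ξ :=
    measurable_tag_comp measurable_id measurable_id
  obtain ⟨Q, hQ⟩ : ∃ Q, Q = mixture ρ (fun ξ => tag ξ ξ) htag := ⟨_, rfl⟩
  have hfst : Q.map measurable_fst.aemeasurable = ρ := by
    rw [hQ, map_mixture ρ htag measurable_fst]
    exact (mixture_congr ρ _ _ fun ξ => ProbabilityMeasure.map_fst_prod _ _).trans
      (mixture_diracProba ρ)
  have hsnd : Q.map measurable_snd.aemeasurable = firstMoment ρ := by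
    rw [hQ, map_mixture ρ htag measurable_snd]
    exact mixture_congr ρ _ measurable_id fun ξ => ProbabilityMeasure.map_snd_prod _ _
  have hint : ∀ F : ProbabilityMeasure S × S → ENNReal, Measurable F →
      (∫⁻ p, F p ∂Q.toMeasure) = ∫⁻ ξ, ∫⁻ x, F (ξ, x) ∂ξ.toMeasure ∂ρ.toMeasure := by
    intro F hF
    rw [hQ, lintegral_mixture ρ htag hF]
    refine lintegral_congr fun ξ => ?_
    rw [tag_eq_map]
    exact lintegral_map hF measurable_prodMk_left
  refine convexLE_iff.2 ⟨Q.map hφ.aemeasurable, ?_, ?_, ?_⟩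
  · refine isMartingaleCoupling_iff.2 fun B A hB hA => ?_
    have hB' : MeasurableSet (Prod.fst ⁻¹' B : Set (ProbabilityMeasure S × S)) :=
      measurable_fst hB
    have m1 : Measurable fun p : ProbabilityMeasure S × S => (p.1 : Measure S) A :=
      measurable_coe_measure measurable_fst hA
    have m2 : Measurable fun p : ProbabilityMeasure S × S => (diracProba p.2 : Measure S) A :=
      measurable_coe_measure (measurable_diracProba.comp measurable_snd) hA
    refine (setLIntegral_map (measurable_fst hB) (measurable_coe_measure measurable_fst hA)
      hφ).trans (Eq.trans ?_ (setLIntegral_map (measurable_fst hB)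
        (measurable_coe_measure measurable_snd hA) hφ).symm)
    change ∫⁻ p in Prod.fst ⁻¹' B, (p.1 : Measure S) A ∂Q.toMeasure
      = ∫⁻ p in Prod.fst ⁻¹' B, (diracProba p.2 : Measure S) A ∂Q.toMeasure
    rw [← lintegral_indicator hB', ← lintegral_indicator hB', hint _ (m1.indicator hB'),
      hint _ (m2.indicator hB')]
    refine lintegral_congr fun ξ => ?_
    by_cases h : ξ ∈ B
    · simp only [Set.indicator, Set.mem_preimage, h, if_true, lintegral_const, measure_univ,
        mul_one]
      simp only [diracProba_toMeasure_apply' _ hA]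
      exact (lintegral_indicator_one hA).symm
    · simp [Set.indicator, h]
  · exact (Subtype.ext (Measure.map_map measurable_fst hφ)).trans hfst
  · rw [← hsnd]
    refine Subtype.ext ((Measure.map_map measurable_snd hφ).trans ?_)
    exact (Measure.map_map measurable_diracProba measurable_snd).symm

/-- The mean is constant along the convex order. -/
theorem IsMartingaleCoupling.firstMoment_eq
    {Q : ProbabilityMeasure (ProbabilityMeasure S × ProbabilityMeasure S)}
    (hQ : IsMartingaleCoupling Q) :
    firstMoment (Q.map measurable_fst.aemeasurable)
      = firstMoment (Q.map measurable_snd.aemeasurable) := by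
  rw [firstMoment_eq_mixture, firstMoment_eq_mixture, mixture_map Q measurable_fst,
    mixture_map Q measurable_snd]
  refine Subtype.ext (Measure.ext fun A hA => ?_)
  refine (mixture_apply _ _ hA).trans (Eq.trans ?_ (mixture_apply _ _ hA).symm)
  simpa using isMartingaleCoupling_iff.1 hQ Set.univ A .univ hA

end Coupling

/-! ### The maps `T` and `Ť` -/

theorem map_map_probabilityMeasure {X Y Z : Type*} [MeasurableSpace X] [MeasurableSpace Y]
    [MeasurableSpace Z] (μ : ProbabilityMeasure X) {f : X → Y} (hf : Measurable f) {g : Y → Z}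
    (hg : Measurable g) :
    (μ.map hf.aemeasurable).map hg.aemeasurable
      = μ.map (f := fun x => g (f x)) (hg.comp hf).aemeasurable :=
  Subtype.ext (Measure.map_map hg hf)

theorem map_congr_probabilityMeasure {X Y : Type*} [MeasurableSpace X] [MeasurableSpace Y]
    (μ : ProbabilityMeasure X) {f g : X → Y} (hf : Measurable f) (hg : Measurable g)
    (h : ∀ x, f x = g x) : μ.map hf.aemeasurable = μ.map hg.aemeasurable := by
  obtain rfl : f = g := funext h
  rfl

/-- `T_g` commutes with images under maps that intertwine the maps `g`. -/
theorem map_mapT {X Y : Type u} [MeasurableSpace X] [MeasurableSpace Y] {ι : Type}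
    {g : (ι → X) → X} (hg : Measurable g) {g' : (ι → Y) → Y} (hg' : Measurable g')
    {φ : X → Y} (hφ : Measurable φ) (h : ∀ x, φ (g x) = g' fun i => φ (x i))
    (μ : ProbabilityMeasure X) :
    (mapT g hg μ).map hφ.aemeasurable = mapT g' hg' (μ.map hφ.aemeasurable) := by
  have hφι : Measurable fun (x : ι → X) i => φ (x i) :=
    measurable_pi_lambda _ fun i => hφ.comp (measurable_pi_apply i)
  have h1 : (infProd fun _ : ι => μ).map hφι.aemeasurable
      = infProd fun _ : ι => μ.map hφ.aemeasurable := infProd_map _ fun _ => hφ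
  have h2 : mapT g' hg' (μ.map hφ.aemeasurable)
      = (infProd fun _ : ι => μ.map hφ.aemeasurable).map hg'.aemeasurable := rfl
  have h3 : mapT g hg μ = (infProd fun _ : ι => μ).map hg.aemeasurable := rfl
  rw [h2, h3, ← h1, map_map_probabilityMeasure _ hg hφ, map_map_probabilityMeasure _ hφι hg']
  exact map_congr_probabilityMeasure _ (hφ.comp hg) (hg'.comp hφι) h

theorem measurable_checkMap_const {S : Type u} [MeasurableSpace S] {ι : Type} {g : (ι → S) → S}
    (hg : Measurable g) : Measurable (checkMap g hg) :=
  (measurable_map_probabilityMeasure hg).comp (measurable_infProd ι)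

theorem checkMap_diracProba {S : Type u} [MeasurableSpace S] {ι : Type} {g : (ι → S) → S}
    (hg : Measurable g) (x : ι → S) :
    checkMap g hg (fun i => diracProba (x i)) = diracProba (g x) := by
  rw [checkMap_eq_map, infProd_diracProba]
  exact Subtype.ext (Measure.map_dirac' hg x)

/-- If the `ξ i` are i.i.d. with law `ρ`, then the mean of `ǧ(ξ)` is `T_g` of the mean of `ρ`. -/
theorem firstMoment_mapT_checkMap {S : Type u} [MeasurableSpace S] {ι : Type} {g : (ι → S) → S}
    (hg : Measurable g) (ρ : ProbabilityMeasure (ProbabilityMeasure S)) :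
    firstMoment (mapT (checkMap g hg) (measurable_checkMap_const hg) ρ)
      = mapT g hg (firstMoment ρ) := by
  have h1 : mapT (checkMap g hg) (measurable_checkMap_const hg) ρ
      = (infProd fun _ : ι => ρ).map (measurable_checkMap_const hg).aemeasurable := rfl
  have h2 : mapT g hg (firstMoment ρ)
      = (infProd fun _ : ι => mixture ρ id measurable_id).map hg.aemeasurable := rfl
  rw [firstMoment_eq_mixture, h1, h2, mixture_map _ (measurable_checkMap_const hg),
    ← mixture_infProd, map_mixture _ _ hg]
  rfl

namespace RandomMap

variable {Ω : Type v} [MeasurableSpace Ω]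

section

variable {X Y : Type u} [MeasurableSpace X] [MeasurableSpace Y]

theorem T_eq_mixture (D : RandomMap Ω X) (r : ProbabilityMeasure Ω) (μ : ProbabilityMeasure X) :
    D.T r μ = mixture r (fun ω => mapT (D.eval ω) (D.measurable_eval ω) μ)
      (D.measurable_mapT_eval μ) :=
  rfl

theorem map_T (D : RandomMap Ω X) (D' : RandomMap Ω Y) (r : ProbabilityMeasure Ω) {φ : X → Y}
    (hφ : Measurable φ) (μ : ProbabilityMeasure X)
    (h : ∀ ω, (mapT (D.eval ω) (D.measurable_eval ω) μ).map hφ.aemeasurable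
      = mapT (D'.eval ω) (D'.measurable_eval ω) (μ.map hφ.aemeasurable)) :
    (D.T r μ).map hφ.aemeasurable = D'.T r (μ.map hφ.aemeasurable) := by
  rw [T_eq_mixture, T_eq_mixture, map_mixture _ _ hφ]
  exact mixture_congr _ _ _ h

/-- The random map acting on pairs, with the same `γ[ω]` applied to both components. -/
def square (D : RandomMap Ω X) : RandomMap Ω (X × X) where
  κ := D.κ
  measurable_κ := D.measurable_κ
  γ := fun k ω x => (D.γ k ω fun i => (x i).1, D.γ k ω fun i => (x i).2)
  measurable_γ := fun k => by
    refine ((D.measurable_γ k).comp (measurable_fst.prodMk ?_)).prodMk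
      ((D.measurable_γ k).comp (measurable_fst.prodMk ?_))
    · exact measurable_pi_lambda _ fun i =>
        measurable_fst.comp ((measurable_pi_apply i).comp measurable_snd)
    · exact measurable_pi_lambda _ fun i =>
        measurable_snd.comp ((measurable_pi_apply i).comp measurable_snd)

theorem map_fst_square_T (D : RandomMap Ω X) (r : ProbabilityMeasure Ω)
    (Q : ProbabilityMeasure (X × X)) :
    (D.square.T r Q).map measurable_fst.aemeasurable
      = D.T r (Q.map measurable_fst.aemeasurable) :=
  map_T _ _ r measurable_fst Q fun _ => map_mapT _ _ measurable_fst (fun _ => rfl) Q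

theorem map_snd_square_T (D : RandomMap Ω X) (r : ProbabilityMeasure Ω)
    (Q : ProbabilityMeasure (X × X)) :
    (D.square.T r Q).map measurable_snd.aemeasurable
      = D.T r (Q.map measurable_snd.aemeasurable) :=
  map_T _ _ r measurable_snd Q fun _ => map_mapT _ _ measurable_snd (fun _ => rfl) Q

end

variable {S : Type u} [MeasurableSpace S]

theorem firstMoment_higherT (D : RandomMap Ω S) (r : ProbabilityMeasure Ω)
    (ρ : ProbabilityMeasure (ProbabilityMeasure S)) :
    firstMoment (D.higherT r ρ) = D.T r (firstMoment ρ) := by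
  have h1 : D.higherT r ρ = D.check.T r ρ := rfl
  rw [h1, firstMoment_eq_mixture, T_eq_mixture, T_eq_mixture, mixture_mixture _ _ _
    (measurable_mixture (D.check.measurable_mapT_eval ρ) measurable_id)]
  exact mixture_congr _ _ _ fun ω => firstMoment_mapT_checkMap (D.measurable_eval ω) ρ

theorem higherT_diracLaw (D : RandomMap Ω S) (r : ProbabilityMeasure Ω)
    (μ : ProbabilityMeasure S) : D.higherT r (diracLaw μ) = diracLaw (D.T r μ) :=
  (map_T D D.check r measurable_diracProba μ fun ω => map_mapT _ _ measurable_diracProba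
    (fun x => (checkMap_diracProba (D.measurable_eval ω) x).symm) μ).symm

end RandomMap

section Monotone

variable {S : Type u} [MeasurableSpace S]

/-- Sampling from `ǧ(b)` while recording `ǧ(a)` amounts to sampling independent points from the
`b i` while recording the `a i`, and then applying `ǧ` and `g` to the results. -/
theorem tag_checkMap {ι : Type} {g : (ι → S) → S} (hg : Measurable g)
    (a b : ι → ProbabilityMeasure S)
    (hΨ : Measurable fun y : ι → ProbabilityMeasure S × S =>
      (checkMap g hg fun i => (y i).1, g fun i => (y i).2)) :
    tag (checkMap g hg a) (checkMap g hg b)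
      = (infProd fun i => tag (a i) (b i)).map hΨ.aemeasurable := by
  have ha : Measurable fun (x : ι → S) i => (a i, x i) :=
    measurable_pi_lambda _ fun i => measurable_const.prodMk (measurable_pi_apply i)
  have h1 : (infProd fun i => tag (a i) (b i)) = (infProd b).map ha.aemeasurable := by
    rw [infProd_map b (f := fun i x => (a i, x)) fun i => measurable_prodMk_left]
    simp_rw [tag_eq_map]
  rw [h1, tag_eq_map, checkMap_eq_map g hg b,
    map_map_probabilityMeasure _ hg measurable_prodMk_left, map_map_probabilityMeasure _ ha hΨ]

/-- Applying `ǧ` to i.i.d. copies preserves the martingale property: in each coordinate, the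
second random measure may be replaced by the first one, as far as the joint law of the first
random measures and the sampled points is concerned. -/
theorem IsMartingaleCoupling.mapT {ι : Type} {g : (ι → S) → S} (hg : Measurable g)
    {Q : ProbabilityMeasure (ProbabilityMeasure S × ProbabilityMeasure S)}
    (hQ : IsMartingaleCoupling Q) {G : (ι → ProbabilityMeasure S × ProbabilityMeasure S) →
      ProbabilityMeasure S × ProbabilityMeasure S} (hG : Measurable G)
    (hGg : ∀ z, G z = (checkMap g hg fun i => (z i).1, checkMap g hg fun i => (z i).2)) :
    IsMartingaleCoupling (mapT G hG Q) := by
  have hΨ : Measurable fun y : ι → ProbabilityMeasure S × S =>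
      (checkMap g hg fun i => (y i).1, g fun i => (y i).2) :=
    ((measurable_checkMap_const hg).comp (measurable_pi_lambda _ fun i =>
        measurable_fst.comp (measurable_pi_apply i))).prodMk
      (hg.comp (measurable_pi_lambda _ fun i => measurable_snd.comp (measurable_pi_apply i)))
  have h1 : HigherRDE.mapT G hG Q = (infProd fun _ : ι => Q).map hG.aemeasurable := rfl
  have key : ∀ (f : ProbabilityMeasure S × ProbabilityMeasure S → ProbabilityMeasure S)
      (hf : Measurable f) (_ : ∀ z, f (G z) = checkMap g hg fun i => f (z i)),
      mixture (HigherRDE.mapT G hG Q) (fun z => tag z.1 (f z))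
          (measurable_tag_comp measurable_fst hf)
        = (infProd fun _ : ι => mixture Q (fun z => tag z.1 (f z))
          (measurable_tag_comp measurable_fst hf)).map hΨ.aemeasurable := by
    intro f hf hfG
    rw [h1, mixture_map _ hG, ← mixture_infProd, map_mixture _ _ hΨ]
    refine mixture_congr _ _ _ fun z => ?_
    rw [hfG, hGg, tag_checkMap hg _ _ hΨ]
  have e1 := key Prod.fst measurable_fst fun z => by rw [hGg]
  have e2 := key Prod.snd measurable_snd fun z => by rw [hGg]
  exact e1.trans (Eq.trans (by rw [hQ]) e2.symm)

theorem IsMartingaleCoupling.square_T {Ω : Type v} [MeasurableSpace Ω] (D : RandomMap Ω S)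
    (r : ProbabilityMeasure Ω)
    {Q : ProbabilityMeasure (ProbabilityMeasure S × ProbabilityMeasure S)}
    (hQ : IsMartingaleCoupling Q) : IsMartingaleCoupling (D.check.square.T r Q) := by
  have hm := D.check.square.measurable_mapT_eval Q
  have e1 := mixture_mixture r hm measurable_tag_self (measurable_mixture hm measurable_tag_self)
  have e2 := mixture_mixture r hm measurable_tag (measurable_mixture hm measurable_tag)
  refine e1.trans (Eq.trans ?_ e2.symm)
  exact mixture_congr _ _ _ fun ω =>
    hQ.mapT (D.measurable_eval ω) (D.check.square.measurable_eval ω) fun _ => rfl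

theorem ConvexLE.higherT {Ω : Type v} [MeasurableSpace Ω] (D : RandomMap Ω S)
    (r : ProbabilityMeasure Ω) {ρ₁ ρ₂ : ProbabilityMeasure (ProbabilityMeasure S)}
    (h : ConvexLE ρ₁ ρ₂) : ConvexLE (D.higherT r ρ₁) (D.higherT r ρ₂) := by
  obtain ⟨Q, hQ, rfl, rfl⟩ := convexLE_iff.1 h
  exact convexLE_iff.2 ⟨D.check.square.T r Q, hQ.square_T D r,
    D.check.map_fst_square_T r Q, D.check.map_snd_square_T r Q⟩

end Monotone

/-! ### Compactness of the laws with a given mean -/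

section Compactness

variable {S : Type u} [TopologicalSpace S] [PolishSpace S] [MeasurableSpace S] [BorelSpace S]

instance instSecondCountableProbabilityMeasure : SecondCountableTopology (ProbabilityMeasure S) :=
  ⟨⟨weakSubbasis S, countable_weakSubbasis, weak_eq_generateFrom⟩⟩

/-- Taking the mean is weakly continuous, because integrating a bounded continuous function against
`ξ` is a bounded continuous function of `ξ`. -/
theorem continuous_firstMoment :
    Continuous (firstMoment : ProbabilityMeasure (ProbabilityMeasure S) → ProbabilityMeasure S) :=
  continuous_mixture measurable_id continuous_id

theorem isClosed_lawsWithMean (μ : ProbabilityMeasure S) : IsClosed (lawsWithMean μ) :=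
  isClosed_eq continuous_firstMoment continuous_const

theorem continuous_tag :
    Continuous fun z : ProbabilityMeasure S × ProbabilityMeasure S => tag z.1 z.2 :=
  ProbabilityMeasure.continuous_prod.comp
    ((continuous_diracProba.comp continuous_fst).prodMk continuous_snd)

theorem isClosed_isMartingaleCoupling :
    IsClosed {Q : ProbabilityMeasure (ProbabilityMeasure S × ProbabilityMeasure S) |
      IsMartingaleCoupling Q} :=
  isClosed_eq
    (continuous_mixture _ (continuous_tag.comp (continuous_fst.prodMk continuous_fst)))
    (continuous_mixture _ continuous_tag)

/-- The laws with mean `μ` are tight: if `μ (K n)ᶜ` decreases fast for compact sets `K n`, then, by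
Markov's inequality, they give large mass to the set of all `ξ` for which `ξ (K n)ᶜ` is small for
all `n`, which is compact by Prokhorov's theorem. -/
theorem isTightMeasureSet_lawsWithMean (μ : ProbabilityMeasure S) :
    IsTightMeasureSet {x | ∃ ρ ∈ lawsWithMean μ, (ρ : Measure (ProbabilityMeasure S)) = x} := by
  rw [isTightMeasureSet_iff_exists_isCompact_measure_compl_le]
  intro ε hε
  obtain ⟨δ, hδ, hδε⟩ := ENNReal.exists_pos_sum_of_countable' hε.ne' ℕ
  obtain ⟨u, -, u_pos, u_lim⟩ := exists_seq_strictAnti_tendsto (0 : NNReal)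
  have hK : ∀ n, ∃ K : Set S, IsCompact K ∧ (μ : Measure S) Kᶜ ≤ δ n * u n := by
    intro n
    have h := isTightMeasureSet_iff_exists_isCompact_measure_compl_le.1
      (isTightMeasureSet_singleton (μ := (μ : Measure S))) (δ n * u n)
      (ENNReal.mul_pos (hδ n).ne' (by simpa using (u_pos n).ne'))
    obtain ⟨K, hK, h⟩ := h
    exact ⟨K, hK, h _ rfl⟩
  choose K hKc hK using hK
  refine ⟨{ξ | ∀ n, ξ (K n)ᶜ ≤ u n},
    isCompact_setOfPred_probabilityMeasure_mass_eq_compl_isCompact_le u_lim hKc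
      (Or.inl inferInstance), ?_⟩
  rintro _ ⟨ρ, hρ, rfl⟩
  have hρμ : firstMoment ρ = μ := hρ
  have hKm : ∀ n, MeasurableSet (K n)ᶜ := fun n => (hKc n).measurableSet.compl
  have hmark : ∀ n, (ρ : Measure (ProbabilityMeasure S)) {ξ | (u n : ENNReal) ≤
      (ξ : Measure S) (K n)ᶜ} ≤ δ n := by
    intro n
    have h1 := mul_meas_ge_le_lintegral (μ := (ρ : Measure (ProbabilityMeasure S)))
      (measurable_coe_measure measurable_id (hKm n)) (u n)
    have h2 := mixture_apply ρ measurable_id (hKm n)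
    rw [← firstMoment_eq_mixture, hρμ] at h2
    have h3 := (h1.trans h2.ge).trans (hK n)
    rw [mul_comm (δ n)] at h3
    exact (ENNReal.mul_le_mul_iff_right (by simpa using (u_pos n).ne') ENNReal.coe_ne_top).1 h3
  have hsub : {ξ : ProbabilityMeasure S | ∀ n, ξ (K n)ᶜ ≤ u n}ᶜ
      ⊆ ⋃ n, {ξ : ProbabilityMeasure S | (u n : ENNReal) ≤ (ξ : Measure S) (K n)ᶜ} := by
    intro ξ hξ
    simp only [Set.mem_compl_iff, Set.mem_ofPred_eq, not_forall, not_le] at hξ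
    obtain ⟨n, hn⟩ := hξ
    refine Set.mem_iUnion.2 ⟨n, ?_⟩
    rw [Set.mem_ofPred_eq, ← ProbabilityMeasure.ennreal_coeFn_eq_coeFn_toMeasure]
    exact_mod_cast hn.le
  calc (ρ : Measure (ProbabilityMeasure S)) _ ≤ _ := measure_mono hsub
    _ ≤ ∑' n, _ := measure_iUnion_le _
    _ ≤ ∑' n, δ n := ENNReal.tsum_le_tsum hmark
    _ ≤ ε := hδε.le

theorem isCompact_lawsWithMean (μ : ProbabilityMeasure S) : IsCompact (lawsWithMean μ) := by
  have h := isCompact_closure_of_isTightMeasureSet (isTightMeasureSet_lawsWithMean μ)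
  rwa [(isClosed_lawsWithMean μ).closure_eq] at h

theorem continuous_map_fst :
    Continuous fun Q : ProbabilityMeasure (ProbabilityMeasure S × ProbabilityMeasure S) =>
      Q.map measurable_fst.aemeasurable :=
  ProbabilityMeasure.continuous_map continuous_fst

theorem continuous_map_snd :
    Continuous fun Q : ProbabilityMeasure (ProbabilityMeasure S × ProbabilityMeasure S) =>
      Q.map measurable_snd.aemeasurable :=
  ProbabilityMeasure.continuous_map continuous_snd

/-- A family of couplings is tight as soon as its two families of marginals are. -/
theorem isCompact_couplings (μ : ProbabilityMeasure S) :
    IsCompact {Q : ProbabilityMeasure (ProbabilityMeasure S × ProbabilityMeasure S) |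
      Q.map measurable_fst.aemeasurable ∈ lawsWithMean μ ∧
        Q.map measurable_snd.aemeasurable ∈ lawsWithMean μ} := by
  have hcl : IsClosed {Q : ProbabilityMeasure (ProbabilityMeasure S × ProbabilityMeasure S) |
      Q.map measurable_fst.aemeasurable ∈ lawsWithMean μ ∧
        Q.map measurable_snd.aemeasurable ∈ lawsWithMean μ} :=
    ((isClosed_lawsWithMean μ).preimage continuous_map_fst).inter
      ((isClosed_lawsWithMean μ).preimage continuous_map_snd)
  rw [← hcl.closure_eq]
  refine isCompact_closure_of_isTightMeasureSet ?_
  rw [isTightMeasureSet_iff_exists_isCompact_measure_compl_le]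
  intro ε hε
  obtain ⟨K, hK, h⟩ := isTightMeasureSet_iff_exists_isCompact_measure_compl_le.1
    (isTightMeasureSet_lawsWithMean μ) (ε / 2) (ENNReal.half_pos hε.ne')
  refine ⟨K ×ˢ K, hK.prod hK, ?_⟩
  rintro _ ⟨Q, ⟨h1, h2⟩, rfl⟩
  have h1' := h _ ⟨_, h1, rfl⟩
  have h2' := h _ ⟨_, h2, rfl⟩
  rw [ProbabilityMeasure.map_apply' _ _ hK.measurableSet.compl] at h1' h2'
  rw [Set.compl_prod_eq_union, Set.prod_univ, Set.univ_prod]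
  exact (measure_union_le _ _).trans ((add_le_add h1' h2').trans (ENNReal.add_halves ε).le)

/-- Among laws with mean `μ`, the convex order is closed for weak convergence, since the martingale
couplings of such laws form a compact set. -/
theorem isClosed_convexLE (μ : ProbabilityMeasure S) :
    IsClosed {p : ProbabilityMeasure (ProbabilityMeasure S) ×
        ProbabilityMeasure (ProbabilityMeasure S) |
      p.1 ∈ lawsWithMean μ ∧ p.2 ∈ lawsWithMean μ ∧ ConvexLE p.1 p.2} := by
  have h := (((isCompact_couplings μ).inter_right isClosed_isMartingaleCoupling).image
    (continuous_map_fst.prodMk continuous_map_snd)).isClosed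
  convert h using 1
  ext ⟨ρ₁, ρ₂⟩
  constructor
  · rintro ⟨h1, h2, h⟩
    obtain ⟨Q, hQ, rfl, rfl⟩ := convexLE_iff.1 h
    exact ⟨Q, ⟨⟨h1, h2⟩, hQ⟩, rfl⟩
  · rintro ⟨Q, ⟨⟨h1, h2⟩, hQ⟩, h⟩
    obtain ⟨rfl, rfl⟩ := Prod.mk.inj h
    exact ⟨h1, h2, IsMartingaleCoupling.convexLE hQ⟩

end Compactness

/-! ### Second moments along martingale couplings -/

section SecondMoment

theorem measurable_integral_probabilityMeasure {Y : Type*} [MeasurableSpace Y] {f : Y → ℝ}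
    (hf : Measurable f) : Measurable fun ξ : ProbabilityMeasure Y => ∫ y, f y ∂ξ.toMeasure := by
  let κ : ProbabilityTheory.Kernel (ProbabilityMeasure Y) Y :=
    ⟨fun ξ => ξ.toMeasure, measurable_subtype_coe⟩
  have : ProbabilityTheory.IsMarkovKernel κ :=
    ⟨fun ξ => inferInstanceAs (IsProbabilityMeasure ξ.toMeasure)⟩
  exact (hf.stronglyMeasurable.integral_kernel (κ := κ)).measurable

theorem abs_integral_le {Y : Type*} [MeasurableSpace Y] (ξ : ProbabilityMeasure Y) {f : Y → ℝ}
    {C : ℝ} (hC : ∀ y, |f y| ≤ C) : |∫ y, f y ∂ξ.toMeasure| ≤ C := by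
  simpa using norm_integral_le_of_norm_le_const (μ := ξ.toMeasure) (f := f) (C := C)
    (ae_of_all _ hC)

variable {S : Type u} [MeasurableSpace S]

/-- The increments of a martingale are orthogonal to its past. -/
theorem IsMartingaleCoupling.integral_mul
    {Q : ProbabilityMeasure (ProbabilityMeasure S × ProbabilityMeasure S)}
    (hQ : IsMartingaleCoupling Q) {f : S → ℝ} (hf : Measurable f) {C : ℝ} (hC : ∀ x, |f x| ≤ C) :
    ∫ z, (∫ x, f x ∂z.1.toMeasure) * ∫ x, f x ∂z.2.toMeasure ∂Q.toMeasure
      = ∫ z, (∫ x, f x ∂z.1.toMeasure) ^ 2 ∂Q.toMeasure := by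
  let F : ProbabilityMeasure S × S → ℝ := fun p => (∫ x, f x ∂p.1.toMeasure) * f p.2
  have hF : Measurable F :=
    ((measurable_integral_probabilityMeasure hf).comp measurable_fst).mul (hf.comp measurable_snd)
  have hFC : ∀ p, |F p| ≤ C * C := fun p => by
    rw [abs_mul]
    exact mul_le_mul (abs_integral_le p.1 hC) (hC _) (abs_nonneg _)
      ((abs_nonneg _).trans (hC p.2))
  have hFtag : ∀ ξ ζ : ProbabilityMeasure S, ∫ p, F p ∂(tag ξ ζ).toMeasure
      = (∫ x, f x ∂ξ.toMeasure) * ∫ x, f x ∂ζ.toMeasure := by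
    intro ξ ζ
    rw [tag_eq_map]
    refine (integral_map measurable_prodMk_left.aemeasurable hF.aestronglyMeasurable).trans ?_
    exact integral_const_mul (∫ x, f x ∂ξ.toMeasure) f
  have e1 := integral_mixture Q measurable_tag_self hF hFC
  have e2 := integral_mixture Q measurable_tag hF hFC
  rw [hQ] at e1
  simp only [hFtag] at e1 e2
  simp only [pow_two]
  exact e2.symm.trans e1

/-- The second moments of `ξ ↦ ∫ f dξ` increase along a martingale, by the second moment of the
increment. -/
theorem IsMartingaleCoupling.integral_sub_sq
    {Q : ProbabilityMeasure (ProbabilityMeasure S × ProbabilityMeasure S)}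
    (hQ : IsMartingaleCoupling Q) {f : S → ℝ} (hf : Measurable f) {C : ℝ} (hC : ∀ x, |f x| ≤ C) :
    ∫ z, ((∫ x, f x ∂z.1.toMeasure) - ∫ x, f x ∂z.2.toMeasure) ^ 2 ∂Q.toMeasure
      = ∫ ξ, (∫ x, f x ∂ξ.toMeasure) ^ 2 ∂(Q.map measurable_snd.aemeasurable).toMeasure
        - ∫ ξ, (∫ x, f x ∂ξ.toMeasure) ^ 2 ∂(Q.map measurable_fst.aemeasurable).toMeasure := by
  have hm := measurable_integral_probabilityMeasure hf
  have m1 : Measurable fun z : ProbabilityMeasure S × ProbabilityMeasure S =>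
    ∫ x, f x ∂z.1.toMeasure := hm.comp measurable_fst
  have m2 : Measurable fun z : ProbabilityMeasure S × ProbabilityMeasure S =>
    ∫ x, f x ∂z.2.toMeasure := hm.comp measurable_snd
  have hb : ∀ ξ ζ : ProbabilityMeasure S,
      |(∫ x, f x ∂ξ.toMeasure) * ∫ x, f x ∂ζ.toMeasure| ≤ C * C := fun ξ ζ => by
    rw [abs_mul]
    exact mul_le_mul (abs_integral_le ξ hC) (abs_integral_le ζ hC) (abs_nonneg _)
      ((abs_nonneg _).trans (abs_integral_le ξ hC))
  have i11 : Integrable (fun z : ProbabilityMeasure S × ProbabilityMeasure S =>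
      (∫ x, f x ∂z.1.toMeasure) ^ 2) Q.toMeasure :=
    integrable_of_bounded (m1.pow_const 2) fun z => by rw [pow_two]; exact hb _ _
  have i22 : Integrable (fun z : ProbabilityMeasure S × ProbabilityMeasure S =>
      (∫ x, f x ∂z.2.toMeasure) ^ 2) Q.toMeasure :=
    integrable_of_bounded (m2.pow_const 2) fun z => by rw [pow_two]; exact hb _ _
  have i12 : Integrable (fun z : ProbabilityMeasure S × ProbabilityMeasure S =>
      (∫ x, f x ∂z.1.toMeasure) * ∫ x, f x ∂z.2.toMeasure) Q.toMeasure :=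
    integrable_of_bounded (m1.mul m2) fun z => hb _ _
  have e1 : ∫ ξ, (∫ x, f x ∂ξ.toMeasure) ^ 2 ∂(Q.map measurable_fst.aemeasurable).toMeasure
      = ∫ z, (∫ x, f x ∂z.1.toMeasure) ^ 2 ∂Q.toMeasure :=
    integral_map measurable_fst.aemeasurable (hm.pow_const 2).aestronglyMeasurable
  have e2 : ∫ ξ, (∫ x, f x ∂ξ.toMeasure) ^ 2 ∂(Q.map measurable_snd.aemeasurable).toMeasure
      = ∫ z, (∫ x, f x ∂z.2.toMeasure) ^ 2 ∂Q.toMeasure :=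
    integral_map measurable_snd.aemeasurable (hm.pow_const 2).aestronglyMeasurable
  have e3 : ∀ z : ProbabilityMeasure S × ProbabilityMeasure S,
      ((∫ x, f x ∂z.1.toMeasure) - ∫ x, f x ∂z.2.toMeasure) ^ 2
        = (∫ x, f x ∂z.1.toMeasure) ^ 2 + (∫ x, f x ∂z.2.toMeasure) ^ 2
          - 2 * ((∫ x, f x ∂z.1.toMeasure) * ∫ x, f x ∂z.2.toMeasure) := fun z => by ring
  simp only [e3]
  have e4 := integral_sub (i11.add i22) (i12.const_mul 2)
  simp only [Pi.add_apply] at e4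
  rw [e1, e2, e4, integral_add i11 i22, integral_const_mul, hQ.integral_mul hf hC]
  ring

theorem abs_measureReal_le_one {Y : Type*} [MeasurableSpace Y] (ξ : ProbabilityMeasure Y)
    (A : Set Y) : |ξ.toMeasure.real A| ≤ 1 := by
  rw [abs_of_nonneg measureReal_nonneg]; exact measureReal_le_one

theorem abs_measureReal_sub_le_one {Y : Type*} [MeasurableSpace Y] (ξ ζ : ProbabilityMeasure Y)
    (A : Set Y) : |ξ.toMeasure.real A - ζ.toMeasure.real A| ≤ 1 :=
  abs_sub_le_of_nonneg_of_le measureReal_nonneg measureReal_le_one measureReal_nonneg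
    measureReal_le_one

theorem IsMartingaleCoupling.integral_sub_sq_real
    {Q : ProbabilityMeasure (ProbabilityMeasure S × ProbabilityMeasure S)}
    (hQ : IsMartingaleCoupling Q) {A : Set S} (hA : MeasurableSet A) :
    ∫ z, (z.1.toMeasure.real A - z.2.toMeasure.real A) ^ 2 ∂Q.toMeasure
      = ∫ ξ, ξ.toMeasure.real A ^ 2 ∂(Q.map measurable_snd.aemeasurable).toMeasure
        - ∫ ξ, ξ.toMeasure.real A ^ 2 ∂(Q.map measurable_fst.aemeasurable).toMeasure := by
  have h := hQ.integral_sub_sq (f := A.indicator fun _ => (1 : ℝ)) (measurable_one.indicator hA)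
    (C := 1) fun x => by by_cases hx : x ∈ A <;> simp [hx]
  have e : ∀ ξ : ProbabilityMeasure S,
      ∫ x, A.indicator (fun _ => (1 : ℝ)) x ∂ξ.toMeasure = ξ.toMeasure.real A := fun ξ =>
    integral_indicator_one hA
  simpa only [e] using h

theorem ConvexLE.integral_sq_le {ρ₁ ρ₂ : ProbabilityMeasure (ProbabilityMeasure S)}
    (h : ConvexLE ρ₁ ρ₂) {A : Set S} (hA : MeasurableSet A) :
    ∫ ξ, ξ.toMeasure.real A ^ 2 ∂ρ₁.toMeasure ≤ ∫ ξ, ξ.toMeasure.real A ^ 2 ∂ρ₂.toMeasure := by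
  obtain ⟨Q, hQ, rfl, rfl⟩ := convexLE_iff.1 h
  rw [← sub_nonneg, ← hQ.integral_sub_sq_real hA]
  exact integral_nonneg fun z => sq_nonneg _

/-- If the second moments do not increase, then the increments of the martingale vanish. -/
theorem ConvexLE.eq_of_integral_sq_le [MeasurableSpace.CountablyGenerated S]
    {ρ₁ ρ₂ : ProbabilityMeasure (ProbabilityMeasure S)} (h : ConvexLE ρ₁ ρ₂)
    (hle : ∀ A : Set S, MeasurableSet A →
      ∫ ξ, ξ.toMeasure.real A ^ 2 ∂ρ₂.toMeasure ≤ ∫ ξ, ξ.toMeasure.real A ^ 2 ∂ρ₁.toMeasure) :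
    ρ₁ = ρ₂ := by
  obtain ⟨Q, hQ, rfl, rfl⟩ := convexLE_iff.1 h
  have hA : ∀ A : Set S, MeasurableSet A →
      ∀ᵐ z ∂Q.toMeasure, z.1.toMeasure.real A = z.2.toMeasure.real A := by
    intro A hA
    have h0 : ∫ z, (z.1.toMeasure.real A - z.2.toMeasure.real A) ^ 2 ∂Q.toMeasure = 0 :=
      le_antisymm (by rw [hQ.integral_sub_sq_real hA]; exact sub_nonpos.2 (hle A hA))
        (integral_nonneg fun z => sq_nonneg _)
    have hi : Integrable (fun z : ProbabilityMeasure S × ProbabilityMeasure S =>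
        (z.1.toMeasure.real A - z.2.toMeasure.real A) ^ 2) Q.toMeasure :=
      integrable_of_bounded (C := 1) (((measurable_real measurable_fst hA).sub
        (measurable_real measurable_snd hA)).pow_const 2) fun z => by
          rw [abs_pow]
          exact pow_le_one₀ (abs_nonneg _) (abs_measureReal_sub_le_one _ _ _)
    filter_upwards [(integral_eq_zero_iff_of_nonneg (fun z => sq_nonneg _) hi).1 h0] with z hz
    exact sub_eq_zero.1 (pow_eq_zero_iff two_ne_zero |>.1 hz)
  -- a countable π-system generating the σ-field gives one null set for all `A` simultaneously
  let 𝒜 := generateSetAlgebra (MeasurableSpace.countableGeneratingSet S)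
  have h𝒜 : 𝒜.Countable :=
    countable_generateSetAlgebra MeasurableSpace.countable_countableGeneratingSet
  have hgen : MeasurableSpace.generateFrom 𝒜 = ‹MeasurableSpace S› :=
    generateFrom_generateSetAlgebra_eq.trans MeasurableSpace.generateFrom_countableGeneratingSet
  have hpi : IsPiSystem 𝒜 := fun s hs t ht _ =>
    (isSetAlgebra_generateSetAlgebra (𝒜 := MeasurableSpace.countableGeneratingSet S)).inter_mem
      hs ht
  have hae : ∀ᵐ z ∂Q.toMeasure, ∀ A ∈ 𝒜, z.1.toMeasure.real A = z.2.toMeasure.real A :=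
    (ae_ball_iff h𝒜).2 fun A hA𝒜 =>
      hA A (hgen ▸ MeasurableSpace.measurableSet_generateFrom hA𝒜)
  refine ProbabilityMeasure.toMeasure_injective (Measure.map_congr ?_)
  filter_upwards [hae] with z hz
  refine ProbabilityMeasure.toMeasure_injective (ext_of_generate_finite 𝒜 hgen.symm hpi
    (fun A hA => ?_) (by simp))
  exact (ENNReal.toReal_eq_toReal_iff' (measure_ne_top _ _) (measure_ne_top _ _)).1 (hz A hA)

theorem ConvexLE.antisymm [MeasurableSpace.CountablyGenerated S]
    {ρ₁ ρ₂ : ProbabilityMeasure (ProbabilityMeasure S)} (h : ConvexLE ρ₁ ρ₂)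
    (h' : ConvexLE ρ₂ ρ₁) : ρ₁ = ρ₂ :=
  h.eq_of_integral_sq_le fun _ hA => h'.integral_sq_le hA

end SecondMoment

/-! ### Increasing sequences in the convex order -/

section Monotone

variable {S : Type u} [TopologicalSpace S] [PolishSpace S] [MeasurableSpace S] [BorelSpace S]

/-- A sequence of laws with mean `μ` that increases in the convex order converges weakly: by
compactness it has cluster points, and any two of them lie below each other. -/
theorem exists_tendsto_of_convexLE {μ : ProbabilityMeasure S}
    {ρ : ℕ → ProbabilityMeasure (ProbabilityMeasure S)} (hρ : ∀ t, ρ t ∈ lawsWithMean μ)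
    (hmono : ∀ s t, s ≤ t → ConvexLE (ρ s) (ρ t)) :
    ∃ ρ' ∈ lawsWithMean μ, Tendsto ρ atTop (𝓝 ρ') := by
  have hle : ∀ ρ', MapClusterPt ρ' atTop ρ → ∀ t, ConvexLE (ρ t) ρ' := by
    intro ρ' h t
    have hcl := (isClosed_convexLE μ).preimage (Continuous.prodMk_right (ρ t))
    exact (hcl.mem_of_mapClusterPt h (by
      filter_upwards [eventually_ge_atTop t] with s hs
      exact ⟨hρ t, hρ s, hmono t s hs⟩)).2.2
  have hle' : ∀ ρ' ∈ lawsWithMean μ, ∀ ρ'', (∀ t, ConvexLE (ρ t) ρ') →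
      MapClusterPt ρ'' atTop ρ → ConvexLE ρ'' ρ' := by
    intro ρ' hρ' ρ'' h h''
    have hcl := (isClosed_convexLE μ).preimage (Continuous.prodMk_left ρ')
    exact (hcl.mem_of_mapClusterPt h'' (Eventually.of_forall fun t => ⟨hρ t, hρ', h t⟩)).2.2
  obtain ⟨ρ', hρ', h⟩ := (isCompact_lawsWithMean μ).exists_mapClusterPt_of_frequently
    (l := atTop) (f := ρ) (Eventually.of_forall hρ).frequently
  refine ⟨ρ', hρ', (isCompact_lawsWithMean μ).tendsto_nhds_of_unique_mapClusterPt
    (Eventually.of_forall hρ) fun ρ'' hρ'' h'' => ?_⟩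
  exact ConvexLE.antisymm (hle' ρ' hρ' ρ'' (hle ρ' h) h'') (hle' ρ'' hρ'' ρ' (hle ρ'' h'') h)

theorem convexLE_of_tendsto {μ : ProbabilityMeasure S} {ι : Type*} {l : Filter ι} [l.NeBot]
    {ρ₁ ρ₂ : ι → ProbabilityMeasure (ProbabilityMeasure S)}
    {ρ₁' ρ₂' : ProbabilityMeasure (ProbabilityMeasure S)} (h₁ : Tendsto ρ₁ l (𝓝 ρ₁'))
    (h₂ : Tendsto ρ₂ l (𝓝 ρ₂')) (hμ : ∀ᶠ i in l, ρ₁ i ∈ lawsWithMean μ ∧ ρ₂ i ∈ lawsWithMean μ ∧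
      ConvexLE (ρ₁ i) (ρ₂ i)) : ConvexLE ρ₁' ρ₂' :=
  ((isClosed_convexLE μ).mem_of_tendsto (h₁.prodMk_nhds h₂) hμ).2.2

end Monotone

/-! ### Mean deviation of two random measures -/

section MeanDev

variable {Z Y : Type*} {mZ : MeasurableSpace Z} {mY : MeasurableSpace Y}

theorem hasSum_measureReal_iUnion (ν : ProbabilityMeasure Y) {f : ℕ → Set Y}
    (hf : ∀ n, MeasurableSet (f n)) (hd : Pairwise (Function.onFun Disjoint f)) :
    HasSum (fun n => ν.toMeasure.real (f n)) (ν.toMeasure.real (⋃ n, f n)) := by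
  have h := VectorMeasure.hasSum_of_disjoint_iUnion (v := ν.toMeasure.toSignedMeasure) hf hd
  simpa only [Measure.toSignedMeasure_apply_measurable (hf _),
    Measure.toSignedMeasure_apply_measurable (MeasurableSet.iUnion hf)] using h

/-- The mean `E|ξ(A) - η(A)|` for random probability measures `ξ` and `η` on a probability space
with law `P`. -/
noncomputable def meanDev (P : ProbabilityMeasure Z) (ξ η : Z → ProbabilityMeasure Y)
    (A : Set Y) : ℝ :=
  ∫ z, |(ξ z).toMeasure.real A - (η z).toMeasure.real A| ∂P.toMeasure

variable {P : ProbabilityMeasure Z} {ξ η : Z → ProbabilityMeasure Y}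

theorem meanDev_nonneg (A : Set Y) : 0 ≤ meanDev P ξ η A :=
  integral_nonneg fun _ => abs_nonneg _

theorem measurable_dev (hξ : Measurable ξ) (hη : Measurable η) {A : Set Y}
    (hA : MeasurableSet A) :
    Measurable fun z => |(ξ z).toMeasure.real A - (η z).toMeasure.real A| :=
  ((measurable_real hξ hA).sub (measurable_real hη hA)).abs

theorem integrable_dev (hξ : Measurable ξ) (hη : Measurable η) {A : Set Y}
    (hA : MeasurableSet A) :
    Integrable (fun z => |(ξ z).toMeasure.real A - (η z).toMeasure.real A|) P.toMeasure :=
  integrable_of_bounded (C := 1) (measurable_dev hξ hη hA) fun z => by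
    rw [abs_abs]; exact abs_measureReal_sub_le_one _ _ _

theorem integrable_real (hξ : Measurable ξ) {A : Set Y} (hA : MeasurableSet A) :
    Integrable (fun z => (ξ z).toMeasure.real A) P.toMeasure :=
  integrable_of_bounded (C := 1) (measurable_real hξ hA) fun _ => abs_measureReal_le_one _ _

theorem integral_real (hξ : Measurable ξ) {A : Set Y} (hA : MeasurableSet A) :
    ∫ z, (ξ z).toMeasure.real A ∂P.toMeasure = (mixture P ξ hξ).toMeasure.real A := by
  rw [Measure.real, mixture_apply P hξ hA]
  exact integral_toReal (measurable_coe_measure hξ hA).aemeasurable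
    (ae_of_all _ fun z => measure_lt_top _ _)

theorem meanDev_le (hξ : Measurable ξ) (hη : Measurable η) {A : Set Y} (hA : MeasurableSet A) :
    meanDev P ξ η A ≤ (mixture P ξ hξ).toMeasure.real A + (mixture P η hη).toMeasure.real A := by
  rw [← integral_real hξ hA, ← integral_real hη hA,
    ← integral_add (integrable_real hξ hA) (integrable_real hη hA)]
  refine integral_mono (integrable_dev hξ hη hA)
    ((integrable_real hξ hA).add (integrable_real hη hA)) fun z => ?_
  refine (abs_sub _ _).trans ?_
  rw [abs_of_nonneg measureReal_nonneg, abs_of_nonneg measureReal_nonneg]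

theorem meanDev_compl {A : Set Y} (hA : MeasurableSet A) :
    meanDev P ξ η Aᶜ = meanDev P ξ η A := by
  refine integral_congr_ae (ae_of_all _ fun z => ?_)
  simp only
  rw [probReal_compl_eq_one_sub hA, probReal_compl_eq_one_sub hA, sub_sub_sub_cancel_left,
    abs_sub_comm]

theorem meanDev_map {W : Type*} [MeasurableSpace W] {P : ProbabilityMeasure W} {φ : W → Z}
    (hφ : Measurable φ) (hξ : Measurable ξ) (hη : Measurable η) {A : Set Y}
    (hA : MeasurableSet A) :
    meanDev (P.map hφ.aemeasurable) ξ η A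
      = meanDev P (fun w => ξ (φ w)) (fun w => η (φ w)) A :=
  integral_map hφ.aemeasurable (measurable_dev hξ hη hA).aestronglyMeasurable

theorem abs_meanSq_sub_le (hξ : Measurable ξ) (hη : Measurable η) {A : Set Y}
    (hA : MeasurableSet A) :
    |∫ z, (ξ z).toMeasure.real A ^ 2 ∂P.toMeasure - ∫ z, (η z).toMeasure.real A ^ 2 ∂P.toMeasure|
      ≤ 2 * meanDev P ξ η A := by
  have hi : ∀ {ζ : Z → ProbabilityMeasure Y}, Measurable ζ →
      Integrable (fun z => (ζ z).toMeasure.real A ^ 2) P.toMeasure := fun {ζ} hζ =>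
    integrable_of_bounded (C := 1) ((measurable_real hζ hA).pow_const 2) fun z => by
      rw [abs_pow]; exact pow_le_one₀ (abs_nonneg _) (abs_measureReal_le_one _ _)
  rw [← integral_sub (hi hξ) (hi hη), meanDev, ← integral_const_mul]
  refine (abs_integral_le_integral_abs).trans
    (integral_mono ((hi hξ).sub (hi hη)).abs ((integrable_dev hξ hη hA).const_mul 2) fun z => ?_)
  simp only
  rw [sq_sub_sq, abs_mul]
  refine mul_le_mul_of_nonneg_right ?_ (abs_nonneg _)
  refine (abs_add_le _ _).trans ?_
  linarith [abs_measureReal_le_one (ξ z) A, abs_measureReal_le_one (η z) A]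

theorem summable_abs_sub_measureReal (ζ ζ' : ProbabilityMeasure Y) {f : ℕ → Set Y}
    (hf : ∀ n, MeasurableSet (f n)) (hd : Pairwise (Function.onFun Disjoint f)) :
    Summable fun n => |ζ.toMeasure.real (f n) - ζ'.toMeasure.real (f n)| :=
  ((hasSum_measureReal_iUnion ζ hf hd).sub (hasSum_measureReal_iUnion ζ' hf hd)).summable.abs

theorem abs_sub_measureReal_iUnion_le (ζ ζ' : ProbabilityMeasure Y) {f : ℕ → Set Y}
    (hf : ∀ n, MeasurableSet (f n)) (hd : Pairwise (Function.onFun Disjoint f)) :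
    |ζ.toMeasure.real (⋃ n, f n) - ζ'.toMeasure.real (⋃ n, f n)|
      ≤ ∑' n, |ζ.toMeasure.real (f n) - ζ'.toMeasure.real (f n)| := by
  have h := (hasSum_measureReal_iUnion ζ hf hd).sub (hasSum_measureReal_iUnion ζ' hf hd)
  rw [← h.tsum_eq]
  exact norm_tsum_le_tsum_norm
    (f := fun n => ζ.toMeasure.real (f n) - ζ'.toMeasure.real (f n))
    (summable_abs_sub_measureReal ζ ζ' hf hd)

theorem tsum_abs_sub_measureReal_le (ζ ζ' : ProbabilityMeasure Y) {f : ℕ → Set Y}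
    (hf : ∀ n, MeasurableSet (f n)) (hd : Pairwise (Function.onFun Disjoint f)) :
    ∑' n, |ζ.toMeasure.real (f n) - ζ'.toMeasure.real (f n)| ≤ 2 := by
  have h := (hasSum_measureReal_iUnion ζ hf hd).add (hasSum_measureReal_iUnion ζ' hf hd)
  have hle : ∀ n, |ζ.toMeasure.real (f n) - ζ'.toMeasure.real (f n)|
      ≤ ζ.toMeasure.real (f n) + ζ'.toMeasure.real (f n) := fun n => by
    refine (abs_sub _ _).trans ?_
    rw [abs_of_nonneg measureReal_nonneg, abs_of_nonneg measureReal_nonneg]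
  refine ((summable_abs_sub_measureReal ζ ζ' hf hd).tsum_le_tsum hle h.summable).trans ?_
  rw [h.tsum_eq]
  linarith [measureReal_le_one (μ := ζ.toMeasure) (s := ⋃ n, f n),
    measureReal_le_one (μ := ζ'.toMeasure) (s := ⋃ n, f n)]

theorem meanDev_iUnion_le (hξ : Measurable ξ) (hη : Measurable η) {f : ℕ → Set Y}
    (hf : ∀ n, MeasurableSet (f n)) (hd : Pairwise (Function.onFun Disjoint f)) :
    meanDev P ξ η (⋃ n, f n) ≤ ∑' n, meanDev P ξ η (f n) := by
  have hs1 := (hasSum_measureReal_iUnion (mixture P ξ hξ) hf hd).summable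
  have hs2 := (hasSum_measureReal_iUnion (mixture P η hη) hf hd).summable
  have hs : Summable fun n => meanDev P ξ η (f n) :=
    Summable.of_nonneg_of_le (fun n => meanDev_nonneg _) (fun n => meanDev_le hξ hη (hf n))
      (hs1.add hs2)
  have hsum := hasSum_integral_of_summable_integral_norm (μ := P.toMeasure)
    (fun n => integrable_dev (P := P) hξ hη (hf n))
    (by simp only [Real.norm_eq_abs, abs_abs]; exact hs)
  have hint : Integrable (fun z => ∑' n, |(ξ z).toMeasure.real (f n)
      - (η z).toMeasure.real (f n)|) P.toMeasure := by
    refine integrable_of_bounded (C := 2) (Measurable.tsum fun n => measurable_dev hξ hη (hf n))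
      fun z => ?_
    rw [abs_of_nonneg (tsum_nonneg fun n => abs_nonneg _)]
    exact tsum_abs_sub_measureReal_le _ _ hf hd
  exact (integral_mono (integrable_dev hξ hη (MeasurableSet.iUnion hf)) hint fun z =>
    abs_sub_measureReal_iUnion_le _ _ hf hd).trans hsum.tsum_eq.ge

/-- If the mean measures are fixed, then the class of sets `A` along which two random measures
become close in mean is a λ-system. -/
theorem tendsto_meanDev_of_isPiSystem {P : ℕ → ProbabilityMeasure Z} (hξ : Measurable ξ)
    (hη : Measurable η) {ν : ProbabilityMeasure Y} (hνξ : ∀ t, mixture (P t) ξ hξ = ν)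
    (hνη : ∀ t, mixture (P t) η hη = ν) {C : Set (Set Y)} (hC : mY = MeasurableSpace.generateFrom C)
    (hpi : IsPiSystem C)
    (h : ∀ A ∈ C, Tendsto (fun t => meanDev (P t) ξ η A) atTop (𝓝 0)) (A : Set Y)
    (hA : MeasurableSet A) : Tendsto (fun t => meanDev (P t) ξ η A) atTop (𝓝 0) := by
  induction A, hA using MeasurableSpace.induction_on_inter hC hpi with
  | empty => simp [meanDev]
  | basic A hA => exact h A hA
  | compl A hA ih => simpa only [meanDev_compl hA] using ih
  | iUnion f hd hf ih =>
    have hs := (hasSum_measureReal_iUnion ν hf hd).summable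
    have ht : Tendsto (fun t => ∑' n, meanDev (P t) ξ η (f n)) atTop (𝓝 (∑' _ : ℕ, (0 : ℝ))) := by
      refine tendsto_tsum_of_dominated_convergence (hs.add hs) ih
        (Eventually.of_forall fun t n => ?_)
      rw [Real.norm_of_nonneg (meanDev_nonneg _)]
      have := meanDev_le (P := P t) hξ hη (hf n)
      rwa [hνξ, hνη] at this
    rw [tsum_zero] at ht
    exact squeeze_zero (fun t => meanDev_nonneg _) (fun t => meanDev_iUnion_le hξ hη hf hd) ht

end MeanDev

/-! ### Convergence in mean along martingale couplings -/

section Convergence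

theorem sq_integral_abs_le {Z : Type*} [MeasurableSpace Z] (P : ProbabilityMeasure Z) {g : Z → ℝ}
    (hg : Measurable g) {C : ℝ} (hC : ∀ z, |g z| ≤ C) :
    (∫ z, |g z| ∂P.toMeasure) ^ 2 ≤ ∫ z, g z ^ 2 ∂P.toMeasure := by
  have i1 : Integrable (fun z => |g z|) P.toMeasure :=
    integrable_of_bounded hg.abs fun z => by rw [abs_abs]; exact hC z
  have i2 : Integrable (fun z => g z ^ 2) P.toMeasure :=
    integrable_of_bounded (hg.pow_const 2) (C := C ^ 2) fun z => by
      rw [abs_pow]; exact pow_le_pow_left₀ (abs_nonneg _) (hC z) 2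
  set m := ∫ z, |g z| ∂P.toMeasure with hm
  -- integrate `(|g| - m) ^ 2 ≥ 0`
  have h0 : 0 ≤ ∫ z, (g z ^ 2 - (2 * m * |g z| - m ^ 2)) ∂P.toMeasure :=
    integral_nonneg fun z => by
      have := sq_nonneg (|g z| - m)
      rw [sub_sq, sq_abs] at this
      simp only [Pi.zero_apply]
      linarith
  have e1 := integral_sub i2 ((i1.const_mul (2 * m)).sub (integrable_const (m ^ 2)))
  have e2 := integral_sub (i1.const_mul (2 * m)) (integrable_const (μ := P.toMeasure) (m ^ 2))
  simp only [Pi.sub_apply] at e1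
  rw [e1, e2, integral_const_mul, ← hm, integral_const, probReal_univ, one_smul] at h0
  linarith

theorem mixture_fst {S : Type u} [MeasurableSpace S]
    (Q : ProbabilityMeasure (ProbabilityMeasure S × ProbabilityMeasure S)) :
    mixture Q Prod.fst measurable_fst = firstMoment (Q.map measurable_fst.aemeasurable) :=
  (mixture_map Q measurable_fst measurable_id).symm

theorem mixture_snd {S : Type u} [MeasurableSpace S]
    (Q : ProbabilityMeasure (ProbabilityMeasure S × ProbabilityMeasure S)) :
    mixture Q Prod.snd measurable_snd = firstMoment (Q.map measurable_snd.aemeasurable) :=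
  (mixture_map Q measurable_snd measurable_id).symm

variable {S : Type u} [TopologicalSpace S] [PolishSpace S] [MeasurableSpace S] [BorelSpace S]

/-- The weak convergence gives convergence of the second moments of `ξ ↦ ∫ f dξ`, which makes the
increments of the martingales small in `L²` and hence in `L¹`. -/
theorem IsMartingaleCoupling.tendsto_integral_abs_sub
    {Q : ℕ → ProbabilityMeasure (ProbabilityMeasure S × ProbabilityMeasure S)}
    (hQ : ∀ t, IsMartingaleCoupling (Q t)) {ρ : ProbabilityMeasure (ProbabilityMeasure S)}
    (hρ : ∀ t, (Q t).map measurable_snd.aemeasurable = ρ)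
    (hlim : Tendsto (fun t => (Q t).map measurable_fst.aemeasurable) atTop (𝓝 ρ))
    {f : S → ℝ} (hf : Continuous f) {C : ℝ} (hC : ∀ x, |f x| ≤ C) :
    Tendsto (fun t => ∫ z, |(∫ x, f x ∂z.1.toMeasure) - ∫ x, f x ∂z.2.toMeasure| ∂(Q t).toMeasure)
      atTop (𝓝 0) := by
  have hc : Continuous fun ξ : ProbabilityMeasure S => (∫ x, f x ∂ξ.toMeasure) ^ 2 :=
    (ProbabilityMeasure.continuous_integral_boundedContinuousFunction
      (BoundedContinuousFunction.ofNormedAddCommGroup f hf C hC)).pow 2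
  have hb : ∀ ξ : ProbabilityMeasure S, ‖(∫ x, f x ∂ξ.toMeasure) ^ 2‖ ≤ C ^ 2 := fun ξ => by
    rw [norm_pow]; exact pow_le_pow_left₀ (norm_nonneg _) (abs_integral_le ξ hC) 2
  have h2 := (ProbabilityMeasure.tendsto_iff_forall_integral_tendsto.1 hlim)
    (BoundedContinuousFunction.ofNormedAddCommGroup _ hc _ hb)
  have hsq : Tendsto (fun t => ∫ z, ((∫ x, f x ∂z.1.toMeasure) - ∫ x, f x ∂z.2.toMeasure) ^ 2
      ∂(Q t).toMeasure) atTop (𝓝 0) := by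
    have h3 := h2.const_sub (∫ ξ, (∫ x, f x ∂ξ.toMeasure) ^ 2 ∂ρ.toMeasure)
    simp only [BoundedContinuousFunction.coe_ofNormedAddCommGroup, sub_self] at h3
    refine h3.congr fun t => ?_
    rw [(hQ t).integral_sub_sq hf.measurable hC, hρ t]
  have hm := measurable_integral_probabilityMeasure (f := f) hf.measurable
  have hsqrt := (Real.continuous_sqrt.tendsto 0).comp hsq
  rw [Real.sqrt_zero] at hsqrt
  refine squeeze_zero (fun t => integral_nonneg fun z => abs_nonneg _) (fun t => ?_) hsqrt
  refine Real.le_sqrt_of_sq_le (sq_integral_abs_le (Q t)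
    ((hm.comp measurable_fst).sub (hm.comp measurable_snd)) (C := C + C) fun z => ?_)
  exact (abs_sub _ _).trans (add_le_add (abs_integral_le _ hC) (abs_integral_le _ hC))

/-- If laws `ρ_t` with a fixed mean lie below `ρ` and converge weakly to `ρ`, then along any
martingale couplings of `ρ_t` and `ρ` one has `E|ξ_t(A) - ξ(A)| → 0` for all Borel sets `A`. For
integrals of continuous functions this follows from convergence of the second moments; one then
passes to closed sets and uses the π-λ theorem. -/
theorem IsMartingaleCoupling.tendsto_meanDev
    {Q : ℕ → ProbabilityMeasure (ProbabilityMeasure S × ProbabilityMeasure S)}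
    (hQ : ∀ t, IsMartingaleCoupling (Q t)) {ρ : ProbabilityMeasure (ProbabilityMeasure S)}
    (hρ : ∀ t, (Q t).map measurable_snd.aemeasurable = ρ)
    (hlim : Tendsto (fun t => (Q t).map measurable_fst.aemeasurable) atTop (𝓝 ρ))
    (A : Set S) (hA : MeasurableSet A) :
    Tendsto (fun t => meanDev (Q t) Prod.fst Prod.snd A) atTop (𝓝 0) := by
  have hν2 : ∀ t, mixture (Q t) Prod.snd measurable_snd = firstMoment ρ := fun t => by
    rw [mixture_snd, hρ]
  have hν1 : ∀ t, mixture (Q t) Prod.fst measurable_fst = firstMoment ρ := fun t => by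
    rw [mixture_fst, (hQ t).firstMoment_eq, hρ]
  refine tendsto_meanDev_of_isPiSystem measurable_fst measurable_snd hν1 hν2
    (BorelSpace.measurable_eq.trans borel_eq_generateFrom_isClosed) isPiSystem_isClosed ?_ A hA
  intro F hF
  let f : ℕ → S → ℝ := fun n x => (hF.apprSeq n x : ℝ)
  have hf : ∀ n, Continuous (f n) := fun n =>
    NNReal.continuous_coe.comp (hF.apprSeq n).continuous
  have hf1 : ∀ n x, |f n x| ≤ 1 := fun n x => by
    rw [abs_of_nonneg (NNReal.coe_nonneg _)]
    exact_mod_cast HasOuterApproxClosed.apprSeq_apply_le_one hF n x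
  have hint : ∀ n (ξ : ProbabilityMeasure S), ∫ x, f n x ∂ξ.toMeasure
      = (∫⁻ x, (hF.apprSeq n x : ENNReal) ∂ξ.toMeasure).toReal := fun n ξ =>
    integral_toReal ((hF.apprSeq n).continuous.measurable.coe_nnreal_ennreal).aemeasurable
      (ae_of_all _ fun x => ENNReal.coe_lt_top)
  have hfF : ∀ n (ξ : ProbabilityMeasure S), ξ.toMeasure.real F ≤ ∫ x, f n x ∂ξ.toMeasure := by
    intro n ξ
    rw [hint]
    refine ENNReal.toReal_mono ?_ (HasOuterApproxClosed.measure_le_lintegral hF ξ.toMeasure n)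
    refine ((lintegral_mono (g := fun _ => 1) fun x => ?_).trans_lt (by simp)).ne
    exact ENNReal.coe_le_one_iff.2 <| HasOuterApproxClosed.apprSeq_apply_le_one hF n x
  have hflim : Tendsto (fun n => ∫ x, f n x ∂(firstMoment ρ).toMeasure) atTop
      (𝓝 ((firstMoment ρ).toMeasure.real F)) := by
    simp only [hint]
    exact (ENNReal.tendsto_toReal (measure_ne_top _ _)).comp
      (HasOuterApproxClosed.tendsto_lintegral_apprSeq hF _)
  have hFm := hF.measurableSet
  have hm : ∀ n, Measurable fun ξ : ProbabilityMeasure S => ∫ x, f n x ∂ξ.toMeasure := fun n =>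
    measurable_integral_probabilityMeasure (hf n).measurable
  -- replacing `F` by its continuous upper approximation `f n` costs the same for both random
  -- measures, uniformly in `t`, because both have mean `firstMoment ρ`
  have hbound : ∀ t n, meanDev (Q t) Prod.fst Prod.snd F
      ≤ ∫ z, |(∫ x, f n x ∂z.1.toMeasure) - ∫ x, f n x ∂z.2.toMeasure| ∂(Q t).toMeasure
        + 2 * ((∫ x, f n x ∂(firstMoment ρ).toMeasure) - (firstMoment ρ).toMeasure.real F) := by
    intro t n
    have m1 : Measurable fun z : ProbabilityMeasure S × ProbabilityMeasure S =>
      ∫ x, f n x ∂z.1.toMeasure := (hm n).comp measurable_fst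
    have m2 : Measurable fun z : ProbabilityMeasure S × ProbabilityMeasure S =>
      ∫ x, f n x ∂z.2.toMeasure := (hm n).comp measurable_snd
    have i1 : Integrable (fun z : ProbabilityMeasure S × ProbabilityMeasure S =>
      ∫ x, f n x ∂z.1.toMeasure) (Q t).toMeasure :=
      integrable_of_bounded m1 fun z => abs_integral_le _ (hf1 n)
    have i2 : Integrable (fun z : ProbabilityMeasure S × ProbabilityMeasure S =>
      ∫ x, f n x ∂z.2.toMeasure) (Q t).toMeasure :=
      integrable_of_bounded m2 fun z => abs_integral_le _ (hf1 n)
    have i12 := (i1.sub i2).abs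
    have j1 : Integrable (fun z : ProbabilityMeasure S × ProbabilityMeasure S =>
      z.1.toMeasure.real F) (Q t).toMeasure := integrable_real measurable_fst hFm
    have j2 : Integrable (fun z : ProbabilityMeasure S × ProbabilityMeasure S =>
      z.2.toMeasure.real F) (Q t).toMeasure := integrable_real measurable_snd hFm
    have e1 : ∫ z, ∫ x, f n x ∂z.1.toMeasure ∂(Q t).toMeasure
        = ∫ x, f n x ∂(firstMoment ρ).toMeasure := by
      rw [← hν1 t]; exact (integral_mixture (Q t) measurable_fst (hf n).measurable (hf1 n)).symm
    have e2 : ∫ z, ∫ x, f n x ∂z.2.toMeasure ∂(Q t).toMeasure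
        = ∫ x, f n x ∂(firstMoment ρ).toMeasure := by
      rw [← hν2 t]; exact (integral_mixture (Q t) measurable_snd (hf n).measurable (hf1 n)).symm
    have e3 : ∫ z, z.1.toMeasure.real F ∂(Q t).toMeasure = (firstMoment ρ).toMeasure.real F := by
      rw [← hν1 t]; exact integral_real measurable_fst hFm
    have e4 : ∫ z, z.2.toMeasure.real F ∂(Q t).toMeasure = (firstMoment ρ).toMeasure.real F := by
      rw [← hν2 t]; exact integral_real measurable_snd hFm
    have hmono : meanDev (Q t) Prod.fst Prod.snd F
        ≤ ∫ z, (|(∫ x, f n x ∂z.1.toMeasure) - ∫ x, f n x ∂z.2.toMeasure|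
          + (((∫ x, f n x ∂z.1.toMeasure) - z.1.toMeasure.real F)
            + ((∫ x, f n x ∂z.2.toMeasure) - z.2.toMeasure.real F))) ∂(Q t).toMeasure := by
      refine integral_mono (integrable_dev measurable_fst measurable_snd hFm)
        (i12.add ((i1.sub j1).add (i2.sub j2))) fun z => ?_
      have a1 := hfF n z.1
      have a2 := hfF n z.2
      rw [abs_le]
      constructor <;>
      linarith [le_abs_self ((∫ x, f n x ∂z.1.toMeasure) - ∫ x, f n x ∂z.2.toMeasure),
        neg_abs_le ((∫ x, f n x ∂z.1.toMeasure) - ∫ x, f n x ∂z.2.toMeasure)]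
    refine hmono.trans (le_of_eq ?_)
    have s1 := integral_add i12 ((i1.sub j1).add (i2.sub j2))
    have s2 := integral_add (i1.sub j1) (i2.sub j2)
    have s3 := integral_sub i1 j1
    have s4 := integral_sub i2 j2
    simp only [Pi.add_apply, Pi.sub_apply] at s1 s2 s3 s4
    rw [s1, s2, s3, s4, e1, e2, e3, e4]
    ring
  refine tendsto_order.2 ⟨fun a ha => Eventually.of_forall fun t =>
    ha.trans_le (meanDev_nonneg _), fun a ha => ?_⟩
  obtain ⟨n, hn⟩ := (hflim.eventually_lt_const (show (firstMoment ρ).toMeasure.real F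
    < (firstMoment ρ).toMeasure.real F + a / 4 by linarith)).exists
  filter_upwards [(IsMartingaleCoupling.tendsto_integral_abs_sub hQ hρ hlim (hf n)
    (hf1 n)).eventually_lt_const (half_pos ha)] with t ht
  linarith [hbound t n]

end Convergence

/-! ### Continuity of `Ť` along increasing sequences -/

section Continuity

theorem abs_prod_sub_prod_le {ι : Type*} (s : Finset ι) {a b : ι → ℝ}
    (ha : ∀ i, |a i| ≤ 1) (hb : ∀ i, |b i| ≤ 1) :
    |∏ i ∈ s, a i - ∏ i ∈ s, b i| ≤ ∑ i ∈ s, |a i - b i| := by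
  classical
  induction s using Finset.induction_on with
  | empty => simp
  | insert j s hj ih =>
    rw [Finset.prod_insert hj, Finset.prod_insert hj, Finset.sum_insert hj]
    have hP : |∏ i ∈ s, b i| ≤ 1 := by
      rw [Finset.abs_prod]
      exact Finset.prod_le_one (fun i _ => abs_nonneg _) fun i _ => hb i
    have e : a j * ∏ i ∈ s, a i - b j * ∏ i ∈ s, b i
        = a j * (∏ i ∈ s, a i - ∏ i ∈ s, b i) + (a j - b j) * ∏ i ∈ s, b i := by ring
    rw [e]
    refine (abs_add_le _ _).trans ?_
    rw [abs_mul, abs_mul, add_comm]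
    refine add_le_add (mul_le_of_le_one_right (abs_nonneg _) hP) ?_
    exact (mul_le_of_le_one_left (abs_nonneg _) (ha j)).trans ih

theorem infProd_real_pi {X : Type*} [MeasurableSpace X] {ι : Type} (ν : ι → ProbabilityMeasure X)
    (s : Finset ι) {t : ι → Set X} (ht : ∀ i, MeasurableSet (t i)) :
    (infProd ν).toMeasure.real ((s : Set ι).pi t) = ∏ i ∈ s, (ν i).toMeasure.real (t i) := by
  have h : (infProd ν).toMeasure ((s : Set ι).pi t) = ∏ i ∈ s, (ν i).toMeasure (t i) :=
    Measure.infinitePi_pi _ fun i _ => ht i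
  rw [Measure.real, h, ENNReal.toReal_prod]
  rfl

variable {S : Type u} [MeasurableSpace S]

/-- If `E|ξ_t(A) - η_t(A)| → 0` for all measurable `A`, then the same holds for products of i.i.d.
copies: for boxes by a telescoping sum, and in general by the π-λ theorem. -/
theorem tendsto_meanDev_infProd {ι : Type}
    {Q : ℕ → ProbabilityMeasure (ProbabilityMeasure S × ProbabilityMeasure S)}
    {ν : ProbabilityMeasure S} (h1 : ∀ t, mixture (Q t) Prod.fst measurable_fst = ν)
    (h2 : ∀ t, mixture (Q t) Prod.snd measurable_snd = ν)
    (h : ∀ A, MeasurableSet A → Tendsto (fun t => meanDev (Q t) Prod.fst Prod.snd A) atTop (𝓝 0))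
    (C : Set (ι → S)) (hC : MeasurableSet C) :
    Tendsto (fun t => meanDev (infProd fun _ : ι => Q t) (fun z => infProd fun i => (z i).1)
      (fun z => infProd fun i => (z i).2) C) atTop (𝓝 0) := by
  refine tendsto_meanDev_of_isPiSystem (measurable_infProd_comp measurable_fst)
    (measurable_infProd_comp measurable_snd) (ν := infProd fun _ => ν)
    (fun t => by rw [mixture_infProd _ measurable_fst, h1])
    (fun t => by rw [mixture_infProd _ measurable_snd, h2])
    (C := squareCylinders fun _ : ι => {s : Set S | MeasurableSet s})
    generateFrom_squareCylinders.symm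
    (isPiSystem_squareCylinders (fun _ => MeasurableSpace.isPiSystem_measurableSet)
      fun _ => MeasurableSet.univ) ?_ C hC
  rintro _ ⟨s, A, hA, rfl⟩
  have hA' : ∀ i, MeasurableSet (A i) := fun i => hA i (Set.mem_univ i)
  have hlim : Tendsto (fun t => ∑ i ∈ s, meanDev (Q t) Prod.fst Prod.snd (A i)) atTop
      (𝓝 (∑ i ∈ s, 0)) := tendsto_finsetSum _ fun i _ => h (A i) (hA' i)
  rw [Finset.sum_const_zero] at hlim
  refine squeeze_zero (fun t => meanDev_nonneg _) (fun t => ?_) hlim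
  have hi : ∀ i, Integrable (fun z : ι → ProbabilityMeasure S × ProbabilityMeasure S =>
      |(z i).1.toMeasure.real (A i) - (z i).2.toMeasure.real (A i)|)
      (infProd fun _ : ι => Q t).toMeasure := fun i =>
    integrable_dev (measurable_fst.comp (measurable_pi_apply i))
      (measurable_snd.comp (measurable_pi_apply i)) (hA' i)
  have e : ∀ i, ∫ z, |(z i).1.toMeasure.real (A i) - (z i).2.toMeasure.real (A i)|
      ∂(infProd fun _ : ι => Q t).toMeasure = meanDev (Q t) Prod.fst Prod.snd (A i) := by
    intro i
    conv_rhs => rw [← infProd_map_eval (fun _ : ι => Q t) i]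
    exact (meanDev_map (measurable_pi_apply i) measurable_fst measurable_snd (hA' i)).symm
  simp only [← e]
  rw [← integral_finsetSum _ fun i _ => hi i]
  refine integral_mono (integrable_dev (measurable_infProd_comp measurable_fst)
    (measurable_infProd_comp measurable_snd) (.pi s.countable_toSet fun i _ => hA' i))
    (integrable_finsetSum _ fun i _ => hi i) fun z => ?_
  simp only [infProd_real_pi _ s hA']
  exact abs_prod_sub_prod_le s (fun i => abs_measureReal_le_one _ _)
    fun i => abs_measureReal_le_one _ _

theorem checkMap_real {ι : Type} {g : (ι → S) → S} (hg : Measurable g)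
    (ν : ι → ProbabilityMeasure S) {A : Set S} (hA : MeasurableSet A) :
    (checkMap g hg ν).toMeasure.real A = (infProd ν).toMeasure.real (g ⁻¹' A) :=
  congrArg ENNReal.toReal (Measure.map_apply hg hA)

/-- Closeness in mean on all measurable sets is preserved by `Ť`: for fixed `ω`, the mean deviation
of `γ̌[ω]` on `A` is that of the product measures on the preimage of `A` under `γ[ω]`. The preimage
is an arbitrary measurable set, so no continuity of `γ[ω]` is needed. -/
theorem tendsto_meanDev_square_T {Ω : Type v} [MeasurableSpace Ω] (r : ProbabilityMeasure Ω)
    (D : RandomMap Ω S) {Q : ℕ → ProbabilityMeasure (ProbabilityMeasure S × ProbabilityMeasure S)}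
    {ν : ProbabilityMeasure S} (h1 : ∀ t, mixture (Q t) Prod.fst measurable_fst = ν)
    (h2 : ∀ t, mixture (Q t) Prod.snd measurable_snd = ν)
    (h : ∀ A, MeasurableSet A → Tendsto (fun t => meanDev (Q t) Prod.fst Prod.snd A) atTop (𝓝 0))
    {A : Set S} (hA : MeasurableSet A) :
    Tendsto (fun t => meanDev (D.check.square.T r (Q t)) Prod.fst Prod.snd A) atTop (𝓝 0) := by
  have hdev := measurable_dev (Z := ProbabilityMeasure S × ProbabilityMeasure S)
    measurable_fst measurable_snd hA
  have e1 : ∀ t, meanDev (D.check.square.T r (Q t)) Prod.fst Prod.snd A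
      = ∫ ω, meanDev (mapT (D.check.square.eval ω) (D.check.square.measurable_eval ω) (Q t))
          Prod.fst Prod.snd A ∂r.toMeasure := fun t =>
    integral_mixture r (D.check.square.measurable_mapT_eval (Q t)) hdev (C := 1) fun z => by
      rw [abs_abs]; exact abs_measureReal_sub_le_one _ _ _
  have e2 : ∀ ω t, meanDev (mapT (D.check.square.eval ω) (D.check.square.measurable_eval ω) (Q t))
      Prod.fst Prod.snd A
      = meanDev (infProd fun _ => Q t) (fun z => infProd fun i => (z i).1)
        (fun z => infProd fun i => (z i).2) (D.eval ω ⁻¹' A) := by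
    intro ω t
    refine (meanDev_map (P := infProd fun _ => Q t) (D.check.square.measurable_eval ω)
      measurable_fst measurable_snd hA).trans ?_
    refine integral_congr_ae (ae_of_all _ fun z => ?_)
    exact congrArg₂ (fun a b => |a - b|) (checkMap_real (D.measurable_eval ω) _ hA)
      (checkMap_real (D.measurable_eval ω) _ hA)
  simp only [e1]
  rw [← integral_zero Ω ℝ (μ := r.toMeasure)]
  refine tendsto_integral_of_dominated_convergence (fun _ => 1) (fun t => ?_)
    (integrable_const _) (fun t => ae_of_all _ fun ω => ?_) (ae_of_all _ fun ω => ?_)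
  · exact ((measurable_integral_probabilityMeasure hdev).comp
      (D.check.square.measurable_mapT_eval (Q t))).aestronglyMeasurable
  · exact abs_integral_le _ fun z => by
      rw [abs_abs]; exact abs_measureReal_sub_le_one _ _ _
  · simp only [e2]
    exact tendsto_meanDev_infProd h1 h2 h _ (D.measurable_eval ω hA)

theorem abs_integral_sq_sub_le
    {Q : ProbabilityMeasure (ProbabilityMeasure S × ProbabilityMeasure S)} {A : Set S}
    (hA : MeasurableSet A) :
    |∫ ξ, ξ.toMeasure.real A ^ 2 ∂(Q.map measurable_fst.aemeasurable).toMeasure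
      - ∫ ξ, ξ.toMeasure.real A ^ 2 ∂(Q.map measurable_snd.aemeasurable).toMeasure|
      ≤ 2 * meanDev Q Prod.fst Prod.snd A := by
  have hm := (measurable_real (K := id) (measurable_id (α := ProbabilityMeasure S)) hA).pow_const 2
  have e1 := integral_map (μ := Q.toMeasure) measurable_fst.aemeasurable hm.aestronglyMeasurable
  have e2 := integral_map (μ := Q.toMeasure) measurable_snd.aemeasurable hm.aestronglyMeasurable
  simp only [id] at e1 e2
  rw [ProbabilityMeasure.toMeasure_map, ProbabilityMeasure.toMeasure_map, e1, e2]
  exact abs_meanSq_sub_le measurable_fst measurable_snd hA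

theorem tendsto_integral_sq
    {Q : ℕ → ProbabilityMeasure (ProbabilityMeasure S × ProbabilityMeasure S)}
    {ρ : ProbabilityMeasure (ProbabilityMeasure S)}
    (hρ : ∀ t, (Q t).map measurable_snd.aemeasurable = ρ) {A : Set S} (hA : MeasurableSet A)
    (h : Tendsto (fun t => meanDev (Q t) Prod.fst Prod.snd A) atTop (𝓝 0)) :
    Tendsto (fun t => ∫ ξ, ξ.toMeasure.real A ^ 2
      ∂((Q t).map measurable_fst.aemeasurable).toMeasure) atTop
      (𝓝 (∫ ξ, ξ.toMeasure.real A ^ 2 ∂ρ.toMeasure)) := by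
  rw [tendsto_iff_norm_sub_tendsto_zero]
  refine squeeze_zero (fun t => norm_nonneg _) (fun t => ?_) (by simpa using h.const_mul 2)
  have := abs_integral_sq_sub_le (Q := Q t) hA
  rwa [hρ] at this

/-- If iterates `ρ t` of `Ť` with a fixed mean lie below `ρ'` in the convex order and converge
weakly to `ρ'`, then `ρ'` is a fixed point of `Ť`. By monotonicity `ρ' ≤ Ť ρ'`; the second moments
of `Ť ρ'` and `ρ'` agree, since both are limits of the second moments along the sequence. -/
theorem higherT_eq_of_tendsto {S : Type u} [TopologicalSpace S] [PolishSpace S]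
    [MeasurableSpace S] [BorelSpace S] {Ω : Type v} [MeasurableSpace Ω]
    (r : ProbabilityMeasure Ω) (D : RandomMap Ω S) {μ : ProbabilityMeasure S}
    {ρ : ℕ → ProbabilityMeasure (ProbabilityMeasure S)}
    {ρ' : ProbabilityMeasure (ProbabilityMeasure S)} (hμ : ∀ t, ρ t ∈ lawsWithMean μ)
    (hsucc : ∀ t, ρ (t + 1) = D.higherT r (ρ t)) (hle : ∀ t, ConvexLE (ρ t) ρ')
    (hlim : Tendsto ρ atTop (𝓝 ρ')) : D.higherT r ρ' = ρ' := by
  have hμ' : ρ' ∈ lawsWithMean μ :=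
    (isClosed_lawsWithMean μ).mem_of_tendsto hlim (Eventually.of_forall hμ)
  choose Q hQ hQ1 hQ2 using fun t => convexLE_iff.1 (hle t)
  have hlim' : Tendsto (fun t => (Q t).map measurable_fst.aemeasurable) atTop (𝓝 ρ') := by
    simpa only [hQ1] using hlim
  have hdev := IsMartingaleCoupling.tendsto_meanDev hQ hQ2 hlim'
  have h1 : ∀ t, mixture (Q t) Prod.fst measurable_fst = μ := fun t => by
    rw [mixture_fst, hQ1]; exact hμ t
  have h2 : ∀ t, mixture (Q t) Prod.snd measurable_snd = μ := fun t => by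
    rw [mixture_snd, hQ2]; exact hμ'
  have hQT1 : ∀ t, (D.check.square.T r (Q t)).map measurable_fst.aemeasurable = ρ (t + 1) :=
    fun t => by rw [D.check.map_fst_square_T, hQ1, hsucc]; rfl
  have hQT2 : ∀ t, (D.check.square.T r (Q t)).map measurable_snd.aemeasurable
      = D.higherT r ρ' := fun t => by rw [D.check.map_snd_square_T, hQ2]; rfl
  have hsq : ∀ A : Set S, MeasurableSet A → ∫ ξ, ξ.toMeasure.real A ^ 2 ∂(D.higherT r ρ').toMeasure
      = ∫ ξ, ξ.toMeasure.real A ^ 2 ∂ρ'.toMeasure := by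
    intro A hA
    have l1 := tendsto_integral_sq hQ2 hA (hdev A hA)
    have l2 := tendsto_integral_sq hQT2 hA (tendsto_meanDev_square_T r D h1 h2 hdev hA)
    simp only [hQ1] at l1
    simp only [hQT1] at l2
    exact tendsto_nhds_unique l2 ((tendsto_add_atTop_iff_nat 1).2 l1)
  have hmono : ConvexLE ρ' (D.higherT r ρ') := by
    have hT : ∀ t, D.higherT r ρ' ∈ lawsWithMean μ ∧ ConvexLE (ρ (t + 1)) (D.higherT r ρ') :=
      fun t => by
        have h := (hle t).higherT D r
        rw [← hsucc] at h
        refine ⟨?_, h⟩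
        obtain ⟨Q', hQ', hQ1', hQ2'⟩ := convexLE_iff.1 h
        have := hQ'.firstMoment_eq
        rw [hQ1', hQ2'] at this
        exact this.symm.trans (hμ (t + 1))
    exact convexLE_of_tendsto (μ := μ) ((tendsto_add_atTop_iff_nat 1).2 hlim) tendsto_const_nhds
      (Eventually.of_forall fun t => ⟨hμ (t + 1), (hT t).1, (hT t).2⟩)
  exact (hmono.eq_of_integral_sq_le fun A hA => (hsq A hA).le).symm

end Continuity

/-! ### Minimal and maximal solutions -/

section Solutions

variable {Ω : Type v} [MeasurableSpace Ω]

theorem ConvexLE.iterate_higherT {S : Type u} [MeasurableSpace S] (D : RandomMap Ω S)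
    (r : ProbabilityMeasure Ω) {ρ₁ ρ₂ : ProbabilityMeasure (ProbabilityMeasure S)}
    (h : ConvexLE ρ₁ ρ₂) (t : ℕ) : ConvexLE ((D.higherT r)^[t] ρ₁) ((D.higherT r)^[t] ρ₂) := by
  induction t with
  | zero => exact h
  | succ t ih =>
    rw [Function.iterate_succ_apply', Function.iterate_succ_apply']
    exact ih.higherT D r

theorem mapsTo_higherT {S : Type u} [MeasurableSpace S] (D : RandomMap Ω S)
    (r : ProbabilityMeasure Ω) {μ : ProbabilityMeasure S} (hμ : D.T r μ = μ) :
    Set.MapsTo (D.higherT r) (lawsWithMean μ) (lawsWithMean μ) := fun ρ hρ => by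
  have hρ' : firstMoment ρ = μ := hρ
  exact (D.firstMoment_higherT r ρ).trans (by rw [hρ', hμ])

theorem diracProba_mem_lawsWithMean {S : Type u} [MeasurableSpace S] (μ : ProbabilityMeasure S) :
    diracProba μ ∈ lawsWithMean μ :=
  Subtype.ext (Measure.dirac_bind measurable_subtype_coe μ)

theorem diracProba_convexLE {S : Type u} [MeasurableSpace S] {μ : ProbabilityMeasure S}
    {ρ : ProbabilityMeasure (ProbabilityMeasure S)} (hρ : ρ ∈ lawsWithMean μ) :
    ConvexLE (diracProba μ) ρ := by
  have h := convexLE_of_firstMoment ρ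
  rwa [show firstMoment ρ = μ from hρ] at h

variable {S : Type u} [TopologicalSpace S] [PolishSpace S] [MeasurableSpace S] [BorelSpace S]

/-- The iterates of `Ť` started in `δ_μ` increase to a fixed point that lies below all other fixed
points with mean `μ`. -/
theorem exists_minimal_solution (D : RandomMap Ω S) (r : ProbabilityMeasure Ω)
    {μ : ProbabilityMeasure S} (hμ : D.T r μ = μ) :
    ∃ μlow ∈ lawsWithMean μ,
      Tendsto (fun t : ℕ => (D.higherT r)^[t] (diracProba μ)) atTop (𝓝 μlow) ∧
      D.higherT r μlow = μlow ∧
      ∀ ρ ∈ lawsWithMean μ, D.higherT r ρ = ρ → ConvexLE μlow ρ := by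
  have hmem : ∀ t, (D.higherT r)^[t] (diracProba μ) ∈ lawsWithMean μ := fun t =>
    (mapsTo_higherT D r hμ).iterate t (diracProba_mem_lawsWithMean μ)
  -- `δ_μ` lies below its `n`-th iterate; apply the `s`-th iterate of `Ť` to both sides
  have hmono : ∀ s t, s ≤ t →
      ConvexLE ((D.higherT r)^[s] (diracProba μ)) ((D.higherT r)^[t] (diracProba μ)) := by
    intro s t hst
    obtain ⟨n, rfl⟩ := Nat.exists_eq_add_of_le hst
    rw [Function.iterate_add_apply]
    exact (diracProba_convexLE (hmem n)).iterate_higherT D r s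
  obtain ⟨μlow, hμlow, hlim⟩ := exists_tendsto_of_convexLE hmem hmono
  have hle : ∀ t, ConvexLE ((D.higherT r)^[t] (diracProba μ)) μlow := fun t =>
    convexLE_of_tendsto (μ := μ) tendsto_const_nhds hlim (by
      filter_upwards [eventually_ge_atTop t] with s hs
      exact ⟨hmem t, hmem s, hmono t s hs⟩)
  refine ⟨μlow, hμlow, hlim, higherT_eq_of_tendsto r D hmem
    (fun t => Function.iterate_succ_apply' _ t _) hle hlim, fun ρ hρ hfix => ?_⟩
  refine convexLE_of_tendsto (μ := μ) hlim tendsto_const_nhds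
    (Eventually.of_forall fun t => ⟨hmem t, hρ, ?_⟩)
  have h := (diracProba_convexLE hρ).iterate_higherT D r t
  rwa [Function.iterate_fixed hfix] at h

end Solutions

end HigherRDE

theorem mainTheorem3
    {S : Type u} [TopologicalSpace S] [PolishSpace S] [MeasurableSpace S] [BorelSpace S]
    {Ω : Type v} [TopologicalSpace Ω] [PolishSpace Ω] [MeasurableSpace Ω] [BorelSpace Ω]
    (r : ProbabilityMeasure Ω) (D : HigherRDE.RandomMap Ω S) :
    (∀ ρ₁ ρ₂ : ProbabilityMeasure (ProbabilityMeasure S),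
      HigherRDE.ConvexLE ρ₁ ρ₂ → HigherRDE.ConvexLE (D.higherT r ρ₁) (D.higherT r ρ₂)) ∧
    ∀ μ : ProbabilityMeasure S, D.T r μ = μ →
      Set.MapsTo (D.higherT r) (HigherRDE.lawsWithMean μ) (HigherRDE.lawsWithMean μ) ∧
      ∃ μlow ∈ HigherRDE.lawsWithMean μ,
        Tendsto (fun t : ℕ => (D.higherT r)^[t] (diracProba μ)) atTop (𝓝 μlow) ∧
        (∀ ν ∈ HigherRDE.lawsWithMean μ,
          Tendsto (fun t : ℕ => (D.higherT r)^[t] (diracProba μ)) atTop (𝓝 ν) → ν = μlow) ∧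
        D.higherT r μlow = μlow ∧
        D.higherT r (HigherRDE.diracLaw μ) = HigherRDE.diracLaw μ ∧
        ∀ ρ ∈ HigherRDE.lawsWithMean μ, D.higherT r ρ = ρ →
          HigherRDE.ConvexLE μlow ρ ∧ HigherRDE.ConvexLE ρ (HigherRDE.diracLaw μ) := by
  refine ⟨fun ρ₁ ρ₂ h => h.higherT D r, fun μ hμ => ⟨HigherRDE.mapsTo_higherT D r hμ, ?_⟩⟩
  obtain ⟨μlow, hμlow, hlim, hfix, hmin⟩ := HigherRDE.exists_minimal_solution D r hμ
  refine ⟨μlow, hμlow, hlim, fun ν _ hν => tendsto_nhds_unique hν hlim, hfix, ?_,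
    fun ρ hρ hρfix => ⟨hmin ρ hρ hρfix, ?_⟩⟩
  · rw [D.higherT_diracLaw, hμ]
  · have h := HigherRDE.convexLE_diracLaw ρ
    rwa [show HigherRDE.firstMoment ρ = μ from hρ] at h
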